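/- **Terminology.** Let $\kappa$ be a regular cardinal and $\mathcal K$ a cocomplete category. For a class $\mathcal X$ of morphisms of $\mathcal K$ let: $\mathrm{Po}(\mathcal X)$ be the class of all isomorphisms and all pushouts of morphisms in $\mathcal X$; $\mathrm{cell}(\mathcal X)$ the class of transfinite composites of morphisms in $\mathrm{Po}(\mathcal X)$; $\mathrm{cof}(\mathcal X)$ (the *$\mathcal X$-cofibrations*) the class of retracts, in the category of morphisms of $\mathcal K$, of morphisms in $\mathrm{cell}(\mathcal X)$; and $\mathrm{cof}_\kappa(\mathcal X)$ the class of $\mathcal X$-cofibrations whose domain and codomain are $\kappa$-presentable. An object $K$ is *$\mathcal X$-cofibrant* if the unique morphism $0\to K$ from an initial object is an $\mathcal X$-cofibration. A poset $P$ is *$\kappa$-good* if it is well-founded, has a least element $\bot$, and $\{y\in P\mid y\le x\}$ has cardinality $<\kappa$ for every $x\in P$; it is *$\kappa$-directed* if every subset of cardinality $<\kappa$ has an upper bound. An element $x$ is *isolated* if $\{y\in P\mid y<x\}$ has a greatest element, denoted $x^-$; it is *limit* if it is neither isolated nor equal to $\bot$. A diagram $D\colon P\to\mathcal K$ is *smooth*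 if for each limit $x\in P$ the cocone $(Dy\to Dx)_{y<x}$ is a colimit cocone. A *$\kappa$-good $\kappa$-directed colimit* is a colimit of a smooth diagram $D\colon P\to\mathcal K$ on a (small) $\kappa$-good $\kappa$-directed poset $P$; the *links* of $D$ are the morphisms $Dx^-\to Dx$ for $x\in P$ isolated. **Statement.** (1) Let $\kappa$ be an uncountable regular cardinal, $\mathcal K$ a locally $\kappa$-presentable category and $\mathcal X$ a class of morphisms between $\kappa$-presentable objects of $\mathcal K$. Then every $\mathcal X$-cofibrant object of $\mathcal K$ is a $\kappa$-good $\kappa$-directed colimit of $\kappa$-presentable $\mathcal X$-cofibrant objects where all links are $\mathcal X$-cofibrations; moreover, the diagram can be chosen so that all links also lie in $\mathrm{Po}(\mathrm{cof}_\kappa(\mathcal X))$. (2) (Kaplansky) Every projective module over a ring is a direct sum of countably generated projective modules. -/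

import Mathlib

open CategoryTheory CategoryTheory.Limits Cardinal

universe w v u

namespace GoodColimits

section Closure

variable {C : Type u} [Category.{v} C]

/-- `Po(X)`: isomorphisms and pushouts of morphisms in `X`. -/
def po (X : MorphismProperty C) : MorphismProperty C :=
  X.pushouts ⊔ MorphismProperty.isomorphisms C

/-- `cell(X) = Tc Po(X)`: transfinite composites of morphisms in `Po(X)`. The lengths range over
all ordinals of the universe `w`, the universe of small sets. -/
def cell (X : MorphismProperty C) : MorphismProperty C :=
  MorphismProperty.transfiniteCompositions.{w} (po X)

/-- `cof(X) = Rt Tc Po(X)`, the class of `X`-cofibrations: retracts, in the category of morphisms,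
of the morphisms in `cell(X)`. -/
def cof (X : MorphismProperty C) : MorphismProperty C :=
  (cell.{w} X).retracts

/-- The class of all morphisms between `κ`-presentable objects. -/
def betweenPresentable (C : Type u) [Category.{v} C] (κ : Cardinal.{w}) [Fact κ.IsRegular] :
    MorphismProperty C :=
  fun A B _ => IsCardinalPresentable A κ ∧ IsCardinalPresentable B κ

/-- `cof_κ(X)`: the `X`-cofibrations between `κ`-presentable objects. -/
def cofPresentable (X : MorphismProperty C) (κ : Cardinal.{w}) [Fact κ.IsRegular] :
    MorphismProperty C :=
  cof.{w} X ⊓ betweenPresentable C κ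

/-- An object `K` is `X`-cofibrant if the unique morphism `0 ⟶ K` from an initial object is an
`X`-cofibration. -/
def IsCofibrantObject (X : MorphismProperty C) (K : C) : Prop :=
  ∃ (I : C) (hI : IsInitial I), cof.{w} X (hI.to K)

end Closure

section Posets

/-- A poset is `κ`-good if it is well-founded, has a least element, and all the initial segments
`{y | y ≤ x}` have cardinality `< κ`. -/
structure IsGoodPoset (κ : Cardinal.{w}) (P : Type w) [PartialOrder P] : Prop where
  wellFounded : WellFounded (fun x y : P => x < y)
  exists_bot : ∃ b : P, IsBot b
  card_Iic_lt : ∀ x : P, #(Set.Iic x) < κ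

/-- A poset is `κ`-directed if every subset of cardinality `< κ` has an upper bound. -/
def IsDirectedPoset (κ : Cardinal.{w}) (P : Type w) [PartialOrder P] : Prop :=
  ∀ S : Set P, #S < κ → BddAbove S

variable {P : Type w} [PartialOrder P]

/-- `y` is the predecessor of the (isolated) element `x`: the greatest element of
`{z | z < x}`. -/
def IsPredecessor (y x : P) : Prop := IsGreatest (Set.Iio x) y

/-- `x` is a limit element: it is neither least nor isolated. -/
def IsLimitElement (x : P) : Prop := ¬ IsBot x ∧ ¬ ∃ y, IsPredecessor y x

end Posets

section Diagrams

variable {C : Type u} [Category.{v} C] {P : Type w} [PartialOrder P]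

/-- The restriction of the diagram `D` to `{y | y < x}`. -/
def restrictBelow (D : P ⥤ C) (x : P) : Set.Iio x ⥤ C :=
  (Subtype.mono_coe (fun y : P => y ∈ Set.Iio x)).functor ⋙ D

/-- The cocone `(D y ⟶ D x)_{y < x}` on the restriction of `D` to `{y | y < x}`. -/
def coconeBelow (D : P ⥤ C) (x : P) : Cocone (restrictBelow D x) where
  pt := D.obj x
  ι :=
    { app := fun y => D.map (homOfLE (le_of_lt y.2))
      naturality := fun y z f => by
        refine ((D.map_comp _ _).symm.trans ?_).trans (Category.comp_id _).symm
        exact congrArg D.map (Subsingleton.elim _ _) }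

/-- A diagram on a poset is smooth if `D x` is the colimit of the `D y`, `y < x`, for every limit
element `x`. A smooth diagram on a `κ`-good poset is a `κ`-good diagram. -/
def IsSmooth (D : P ⥤ C) : Prop :=
  ∀ x : P, IsLimitElement x → Nonempty (IsColimit (coconeBelow D x))

/-- All links `D x⁻ ⟶ D x` of the diagram `D`, for `x` isolated with predecessor `x⁻`, belong to
`W`. -/
def LinksIn (D : P ⥤ C) (W : MorphismProperty C) : Prop :=
  ∀ (x y : P) (h : IsPredecessor y x), W (D.map (homOfLE (le_of_lt h.1)))

end Diagrams

end GoodColimits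

/-! Part (1) rests on a fat small object argument. `exists_fat_small_object` gives a well-founded
`κ`-directed poset `P` with small initial segments and a diagram `D` of `κ`-presentable objects over
`K`, whose latching maps lie in `po X` and along which every lifting problem of `X` against the maps
to `K` is solved at a later stage. Hence `colim D ⟶ K` has the right lifting property against `X`,
and the cofibrant object `K` is a retract of `colim D` (`exists_section_of_isCofibrantObject`).

The resulting idempotent of `colim D` restricts to `colim_S D` for every `S ⊆ P` closed under a
suitable relation with fewer than `κ` values at each point. Splitting it for all such `S` at once
gives a functor `H`, a retract of `S ↦ colim_S D`, with `H(P) ≅ K` (`exists_retract_functor`).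
Adding one element to a lower set pushes out a latching map, so `H(S) ⟶ H(T)` is a retract of a
cellular map, that is, an `X`-cofibration.

It remains to filter `P` by closed subsets of size less than `κ` along a `κ`-good `κ`-directed poset
(`exists_good_filtration`). Each point of `P` enters at an isolated index, so at a limit index the
subset is the union of the earlier ones, which gives smoothness. Uncountability of `κ` keeps
closures small, since closing a point takes countably many steps.

Part (2) uses the same closure lemma with `ℵ₁`: `M` is a retract of the free module on its own
elements, spans of closed subsets are direct summands, and a well-ordered chain of them grows by
countably generated complements. -/

namespace GoodColimits

/-! ### Closures under relations and `κ`-good posets of trees. -/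

section Combinatorics

/-- For an uncountable regular cardinal `κ`, the reflexive transitive closure of a relation with
fewer than `κ` successors at each point has fewer than `κ` successors at each point. -/
theorem mk_reflTransGen_lt {α : Type w} {κ : Cardinal.{w}} (hκ : κ.IsRegular) (hκ' : ℵ₀ < κ)
    {r : α → α → Prop} (hr : ∀ x, #{y | r x y} < κ) (x : α) :
    #{y | Relation.ReflTransGen r x y} < κ := by
  -- `A n` is the set of points reached in exactly `n` steps; the union over `n` stays below `κ`
  -- because `κ` is regular and uncountable.
  let A : ℕ → Set α := fun n => Nat.rec {x} (fun _ S => ⋃ y ∈ S, {z | r y z}) n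
  have hA : ∀ n, #↥(A n) < κ := by
    intro n
    induction n with
    | zero =>
      have : #↥(A 0) = 1 := by simp [A]
      rw [this]
      exact one_lt_aleph0.trans hκ'
    | succ n ih =>
      exact (card_biUnion_lt_iff_forall_of_isRegular hκ ih).2 fun y _ => hr y
  have hU : #(⋃ n : ULift.{w} ℕ, A n.down : Set α) < κ :=
    (card_iUnion_lt_iff_forall_of_isRegular hκ (by simpa using hκ')).2 fun n => hA n.down
  refine (mk_le_mk_of_subset ?_).trans_lt hU
  intro y hy
  rw [Set.mem_iUnion]
  induction hy with
  | refl => exact ⟨⟨0⟩, Set.mem_singleton x⟩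
  | tail _ h ih =>
    obtain ⟨⟨n⟩, hn⟩ := ih
    exact ⟨⟨n + 1⟩, Set.mem_biUnion hn h⟩

/-- Well-founded trees with labels in `Λ` whose nodes have fewer than `κ` children. -/
inductive Tree (Λ : Type w) (κ : Cardinal.{w}) : Type w
  | node (l : Λ) (s : {s : Set κ.out // #s < κ}) (f : s.1 → Tree Λ κ) : Tree Λ κ

namespace Tree

variable {Λ : Type w} {κ : Cardinal.{w}}

/-- The label of the root. -/
def label : Tree Λ κ → Λ
  | node l _ _ => l

/-- The set of the immediate subtrees. -/
def children : Tree Λ κ → Set (Tree Λ κ)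
  | node _ _ f => Set.range f

theorem mk_children_lt (t : Tree Λ κ) : #t.children < κ := by
  obtain ⟨l, s, f⟩ := t
  exact mk_range_le.trans_lt s.2

/-- Any set of fewer than `κ` trees embeds in `κ.out`, so branching over subsets of that one fixed
set already realizes all of them while `Tree` stays in the universe `w`. -/
theorem exists_node (l : Λ) (S : Set (Tree Λ κ)) (hS : #S < κ) :
    ∃ t : Tree Λ κ, t.label = l ∧ t.children = S := by
  have h : #S ≤ #κ.out := by rw [mk_out]; exact hS.le
  obtain ⟨g⟩ := h
  refine ⟨node l ⟨Set.range g, by rwa [mk_range_eq _ g.injective]⟩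
    (fun b => (Equiv.ofInjective g g.injective).symm b), rfl, ?_⟩
  change Set.range _ = _
  ext x
  constructor
  · rintro ⟨b, rfl⟩
    exact Subtype.coe_prop _
  · intro hx
    exact ⟨Equiv.ofInjective g g.injective ⟨x, hx⟩, by simp⟩

theorem wellFounded_mem_children : WellFounded (fun x y : Tree Λ κ => x ∈ y.children) := by
  refine ⟨fun t => ?_⟩
  induction t with
  | node l s f ih =>
    refine ⟨_, ?_⟩
    rintro _ ⟨b, rfl⟩
    exact ih b

theorem wellFounded_transGen :
    WellFounded (Relation.TransGen (fun x y : Tree Λ κ => x ∈ y.children)) :=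
  wellFounded_mem_children.transGen

instance : PartialOrder (Tree Λ κ) where
  le := Relation.ReflTransGen (fun x y : Tree Λ κ => x ∈ y.children)
  lt := Relation.TransGen (fun x y : Tree Λ κ => x ∈ y.children)
  le_refl _ := Relation.ReflTransGen.refl
  le_trans _ _ _ := Relation.ReflTransGen.trans
  lt_iff_le_not_ge x y := by
    constructor
    · intro h
      exact ⟨h.to_reflTransGen, fun h' =>
        wellFounded_transGen.irrefl.irrefl _ (h.trans_left h')⟩
    · rintro ⟨h, h'⟩
      rcases Relation.reflTransGen_iff_eq_or_transGen.1 h with rfl | h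
      · exact (h' Relation.ReflTransGen.refl).elim
      · exact h
  le_antisymm x y h h' := by
    rcases Relation.reflTransGen_iff_eq_or_transGen.1 h with rfl | h
    · rfl
    · exact (wellFounded_transGen.irrefl.irrefl _ (h.trans_left h')).elim

theorem wellFounded_lt : WellFounded (fun x y : Tree Λ κ => x < y) :=
  wellFounded_transGen

theorem lt_iff {x t : Tree Λ κ} : x < t ↔ ∃ y ∈ t.children, x ≤ y := by
  constructor
  · intro h
    obtain ⟨y, h, h'⟩ := Relation.TransGen.tail'_iff.1 h
    exact ⟨y, h', h⟩
  · rintro ⟨y, hy, h⟩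
    exact Relation.TransGen.tail' h hy

theorem mk_Iic_lt (hκ : κ.IsRegular) (hκ' : ℵ₀ < κ) (t : Tree Λ κ) : #(Set.Iic t) < κ := by
  refine (mk_le_mk_of_subset ?_).trans_lt
    (mk_reflTransGen_lt hκ hκ' (r := fun x y : Tree Λ κ => y ∈ x.children) mk_children_lt t)
  intro x hx
  have h : Relation.ReflTransGen (fun x y : Tree Λ κ => x ∈ y.children) x t := hx
  exact h.swap

/-- A node with `S` as its set of children bounds `S`. -/
theorem isDirectedPoset [Nonempty Λ] : IsDirectedPoset κ (Tree Λ κ) := by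
  intro S hS
  obtain ⟨t, -, ht⟩ := exists_node (Classical.arbitrary Λ) S hS
  exact ⟨t, fun x hx => (lt_iff.2 ⟨x, ht ▸ hx, le_rfl⟩).le⟩

end Tree

/-- A well-founded relation with fewer than `κ` predecessors at each point embeds, with isolated
values, in a `κ`-good `κ`-directed poset. -/
theorem exists_isGoodPoset {J : Type w} {κ : Cardinal.{w}} (hκ : κ.IsRegular) (hκ' : ℵ₀ < κ)
    {r : J → J → Prop} (hr : WellFounded r) (hr' : ∀ j, #{i | r i j} < κ) :
    ∃ (Q : Type w) (_ : PartialOrder Q) (ν : J → Q), IsGoodPoset κ Q ∧ IsDirectedPoset κ Q ∧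
      Function.Injective ν ∧ (∀ i j, r i j → ν i ≤ ν j) ∧
      ∀ j, ∃ y, IsPredecessor y (ν j) := by
  classical
  -- Nodes labelled `none` collect the earlier values; above them sits a node labelled `some j` with
  -- a single child. That child is then its predecessor, which makes `ν j` isolated, and the label
  -- makes `ν` injective. `WithBot` supplies the least element.
  let T := Tree (Option J) κ
  have h₁ (S : Set T) (hS : #S < κ) : ∃ t : T, t.label = none ∧ t.children = S :=
    Tree.exists_node none S hS
  have h₂ (j : J) (t : T) : ∃ t' : T, t'.label = some j ∧ t'.children = {t} :=
    Tree.exists_node (some j) {t} (by simpa using one_lt_aleph0.trans hκ')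
  have : Nonempty T := by
    obtain ⟨t, -⟩ := h₁ ∅ (by simpa using (aleph0_pos.trans hκ'))
    exact ⟨t⟩
  choose! n₁ hn₁ hn₁' using h₁
  choose n₂ hn₂ hn₂' using h₂
  let F : ∀ j, (∀ i, r i j → T) → Set T := fun j g => Set.range fun i : {i // r i j} => g i.1 i.2
  let ν : J → T := hr.fix fun j g => n₂ j (n₁ (F j g))
  have hν (j : J) : ν j = n₂ j (n₁ (Set.range fun i : {i // r i j} => ν i)) := hr.fix_eq _ _
  have hν' (j : J) : #(Set.range fun i : {i // r i j} => ν i) < κ :=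
    mk_range_le.trans_lt (hr' j)
  have hlt (j : J) : ∀ x : T, x < ν j ↔ x ≤ n₁ (Set.range fun i : {i // r i j} => ν i) := by
    intro x
    rw [Tree.lt_iff, hν j, hn₂']
    simp
  refine ⟨WithBot T, inferInstance, fun j => (ν j : WithBot T), ?_, ?_, ?_, ?_, ?_⟩
  · have : WellFoundedLT T := ⟨Tree.wellFounded_lt⟩
    refine ⟨wellFounded_lt, ⟨⊥, fun _ => bot_le⟩, fun x => ?_⟩
    induction x with
    | bot =>
      have : (Set.Iic (⊥ : WithBot T)) = {⊥} := by ext; simp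
      rw [this]
      simpa using one_lt_aleph0.trans hκ'
    | coe x =>
      have : Set.Iic (x : WithBot T) ⊆ insert ⊥ ((fun y : T => (y : WithBot T)) '' Set.Iic x) := by
        intro y hy
        induction y with
        | bot => simp
        | coe y => exact Or.inr ⟨y, by simpa using hy, rfl⟩
      refine (mk_le_mk_of_subset this).trans_lt (mk_insert_le.trans_lt ?_)
      exact add_lt_of_lt hκ'.le (mk_image_le.trans_lt (Tree.mk_Iic_lt hκ hκ' x))
        (one_lt_aleph0.trans hκ')
  · intro S hS
    obtain ⟨t, ht⟩ := Tree.isDirectedPoset ((fun y : T => (y : WithBot T)) ⁻¹' S)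
      ((mk_preimage_of_injective _ _ WithBot.coe_injective).trans_lt hS)
    refine ⟨t, fun x hx => ?_⟩
    induction x with
    | bot => exact bot_le
    | coe x => exact WithBot.coe_le_coe.2 (ht hx)
  · intro i j hij
    have : ν i = ν j := WithBot.coe_injective hij
    have h := congrArg Tree.label this
    rw [hν i, hν j, hn₂, hn₂] at h
    exact Option.some_injective _ h
  · intro i j hij
    refine WithBot.coe_le_coe.2 (((hlt j _).2 ?_).le)
    exact (Tree.lt_iff.2 ⟨ν i, by rw [hn₁' _ (hν' j)]; exact ⟨⟨i, hij⟩, rfl⟩, le_rfl⟩).le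
  · intro j
    refine ⟨(n₁ (Set.range fun i : {i // r i j} => ν i) : T), ?_, ?_⟩
    · exact WithBot.coe_lt_coe.2 ((hlt j _).2 le_rfl)
    · intro y hy
      induction y with
      | bot => exact bot_le
      | coe y => exact WithBot.coe_le_coe.2 ((hlt j _).1 (WithBot.coe_lt_coe.1 hy))

end Combinatorics

theorem hasCardinalLT_arrow_of_mk_lt {I : Type w} [PartialOrder I] {κ : Cardinal.{w}}
    [hκ : Fact κ.IsRegular] (hI : #I < κ) : HasCardinalLT (Arrow I) κ := by
  rw [hasCardinalLT_iff_cardinal_mk_lt]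
  have hinj : Function.Injective (fun a : Arrow I => (a.left, a.right)) := by
    rintro ⟨a, b, f⟩ ⟨a', b', f'⟩ h
    obtain ⟨rfl, rfl⟩ := Prod.mk.inj h
    obtain rfl : f = f' := Subsingleton.elim _ _
    rfl
  refine (mk_le_of_injective hinj).trans_lt ?_
  rw [mk_prod]
  simp only [lift_id]
  exact mul_lt_of_lt hκ.out.aleph0_le hI hI

/-! ### Colimits of a diagram over subsets of its indexing poset. -/

section ColimOn

variable {C : Type u} [Category.{v} C] {P : Type w} [PartialOrder P]

/-- The family `ι` is a cocone on the restriction of the diagram `D` to the subset `S`. -/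
def CompatOn (D : P ⥤ C) (S : Set P) {Z : C} (ι : ∀ x ∈ S, D.obj x ⟶ Z) : Prop :=
  ∀ (x y : P) (hx : x ∈ S) (hy : y ∈ S) (h : x ≤ y), D.map (homOfLE h) ≫ ι y hy = ι x hx

/-- The family `ι` is a colimit cocone on the restriction of the diagram `D` to the subset `S`. -/
structure IsColimOn (D : P ⥤ C) (S : Set P) {Z : C} (ι : ∀ x ∈ S, D.obj x ⟶ Z) : Prop where
  compat : CompatOn D S ι
  exists_desc : ∀ {W : C} (f : ∀ x ∈ S, D.obj x ⟶ W) (_ : CompatOn D S f),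
    ∃ g : Z ⟶ W, ∀ x hx, ι x hx ≫ g = f x hx
  hom_ext : ∀ {W : C} {g g' : Z ⟶ W} (_ : ∀ x hx, ι x hx ≫ g = ι x hx ≫ g'), g = g'

/-- The restriction of a diagram on `P` to a subset. -/
abbrev restrictTo (D : P ⥤ C) (S : Set P) : S ⥤ C :=
  (Subtype.mono_coe (fun y : P => y ∈ S)).functor ⋙ D

/-- The cocone on the restriction of `D` to `S` given by a compatible family. -/
def CompatOn.cocone {D : P ⥤ C} {S : Set P} {Z : C} {ι : ∀ x ∈ S, D.obj x ⟶ Z}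
    (h : CompatOn D S ι) : Cocone (restrictTo D S) where
  pt := Z
  ι :=
    { app := fun x => ι x.1 x.2
      naturality := fun x y _ =>
        (h x.1 y.1 x.2 y.2 (leOfHom ‹_›)).trans (Category.comp_id _).symm }

theorem isColimOn_of_isColimit {D : P ⥤ C} {S : Set P} {c : Cocone (restrictTo D S)}
    (hc : IsColimit c) : IsColimOn D S (fun x hx => c.ι.app ⟨x, hx⟩) where
  compat x y hx hy h := c.w (homOfLE h : (⟨x, hx⟩ : S) ⟶ ⟨y, hy⟩)
  exists_desc _ hf := ⟨hc.desc (CompatOn.cocone hf), fun x hx => hc.fac _ ⟨x, hx⟩⟩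
  hom_ext h := hc.hom_ext fun x => h x.1 x.2

theorem IsColimOn.nonempty_isColimit {D : P ⥤ C} {S : Set P} {Z : C}
    {ι : ∀ x ∈ S, D.obj x ⟶ Z} (h : IsColimOn D S ι) : Nonempty (IsColimit h.compat.cocone) := by
  have key (s : Cocone (restrictTo D S)) :
      ∃ g : Z ⟶ s.pt, ∀ x hx, ι x hx ≫ g = s.ι.app ⟨x, hx⟩ :=
    h.exists_desc (fun x hx => s.ι.app ⟨x, hx⟩)
      (fun x y hx hy hxy => s.w (homOfLE hxy : (⟨x, hx⟩ : S) ⟶ ⟨y, hy⟩))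
  choose g hg using key
  exact ⟨{
    desc := g
    fac := fun s x => hg s x.1 x.2
    uniq := fun s m hm => h.hom_ext fun x hx => (hm ⟨x, hx⟩).trans (hg s x hx).symm }⟩

theorem exists_isColimOn [HasColimitsOfSize.{w, w} C] (D : P ⥤ C) (S : Set P) :
    ∃ (Z : C) (ι : ∀ x ∈ S, D.obj x ⟶ Z), IsColimOn D S ι :=
  ⟨_, _, isColimOn_of_isColimit (colimit.isColimit (restrictTo D S))⟩

theorem IsColimOn.isCardinalPresentable [LocallySmall.{w} C] {κ : Cardinal.{w}} [Fact κ.IsRegular]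
    {D : P ⥤ C} {S : Set P} {Z : C} {ι : ∀ x ∈ S, D.obj x ⟶ Z} (h : IsColimOn D S ι)
    (hS : #S < κ) (hD : ∀ x ∈ S, IsCardinalPresentable (D.obj x) κ) :
    IsCardinalPresentable Z κ := by
  obtain ⟨hc⟩ := h.nonempty_isColimit
  have : ∀ k, IsCardinalPresentable ((restrictTo D S).obj k) κ := fun k => hD k.1 k.2
  exact isCardinalPresentable_of_isColimit _ hc κ (hasCardinalLT_arrow_of_mk_lt hS)

theorem CompatOn.mono {D : P ⥤ C} {S T : Set P} (hST : S ⊆ T) {Z : C}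
    {ι : ∀ x ∈ T, D.obj x ⟶ Z} (h : CompatOn D T ι) :
    CompatOn D S (fun x hx => ι x (hST hx)) :=
  fun x y hx hy hxy => h x y (hST hx) (hST hy) hxy

section LeftKan

variable [HasColimitsOfSize.{w, w} C] (D : P ⥤ C)

/-- A colimit of the restriction of `D` to `S`. -/
noncomputable def colimOn (S : Set P) : C :=
  (exists_isColimOn D S).choose

/-- The coprojections to `colimOn D S`. -/
noncomputable def ιOn (S : Set P) (x : P) (hx : x ∈ S) : D.obj x ⟶ colimOn D S :=
  (exists_isColimOn D S).choose_spec.choose x hx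

theorem isColimOn_colimOn (S : Set P) : IsColimOn D S (ιOn D S) :=
  (exists_isColimOn D S).choose_spec.choose_spec

/-- The transition map between the colimits over two subsets. -/
noncomputable def colimOnMap {S T : Set P} (h : S ⊆ T) : colimOn D S ⟶ colimOn D T :=
  ((isColimOn_colimOn D S).exists_desc _ ((isColimOn_colimOn D T).compat.mono h)).choose

theorem ιOn_colimOnMap {S T : Set P} (h : S ⊆ T) (x : P) (hx : x ∈ S) :
    ιOn D S x hx ≫ colimOnMap D h = ιOn D T x (h hx) :=
  ((isColimOn_colimOn D S).exists_desc _
    ((isColimOn_colimOn D T).compat.mono h)).choose_spec x hx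

theorem ιOn_colimOnMap_assoc {S T : Set P} (h : S ⊆ T) (x : P) (hx : x ∈ S) {Z : C}
    (g : colimOn D T ⟶ Z) : ιOn D S x hx ≫ colimOnMap D h ≫ g = ιOn D T x (h hx) ≫ g := by
  rw [← Category.assoc, ιOn_colimOnMap]

/-- The functor `S ↦ colim_S D` on the poset of all subsets. -/
noncomputable def colimOnFunctor : Set P ⥤ C where
  obj S := colimOn D S
  map f := colimOnMap D (leOfHom f)
  map_id S := (isColimOn_colimOn D S).hom_ext fun x hx => by
    rw [ιOn_colimOnMap]; exact (Category.comp_id _).symm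
  map_comp f g := (isColimOn_colimOn D _).hom_ext fun x hx => by
    rw [ιOn_colimOnMap, ιOn_colimOnMap_assoc, ιOn_colimOnMap]

end LeftKan

/-- The latching map of `D` at `x` belongs to `W`. -/
def LatchingIn (D : P ⥤ C) (W : MorphismProperty C) (x : P) : Prop :=
  ∃ (M : C) (ι : ∀ y ∈ Set.Iio x, D.obj y ⟶ M) (l : M ⟶ D.obj x),
    IsColimOn D (Set.Iio x) ι ∧ W l ∧
      ∀ y (hy : y ∈ Set.Iio x), ι y hy ≫ l = D.map (homOfLE (Set.mem_Iio.1 hy).le)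

/-- Adding one element to a lower set pushes out the latching map. -/
theorem isPushout_colimOn_insert [HasColimitsOfSize.{w, w} C] (D : P ⥤ C) {S T : Set P}
    (hS : IsLowerSet S) {x : P} (hx : x ∉ S) (hxS : Set.Iio x ⊆ S) (hST : S ⊆ T)
    (hxT : x ∈ T) (hT : T ⊆ insert x S)
    {M : C} {ι : ∀ y ∈ Set.Iio x, D.obj y ⟶ M} (hι : IsColimOn D (Set.Iio x) ι)
    {l : M ⟶ D.obj x}
    (hl : ∀ y (hy : y ∈ Set.Iio x), ι y hy ≫ l = D.map (homOfLE (Set.mem_Iio.1 hy).le)) :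
    ∃ a : M ⟶ colimOn D S, IsPushout a l (colimOnMap D hST) (ιOn D T x hxT) := by
  classical
  have cS := isColimOn_colimOn D S
  have cT := isColimOn_colimOn D T
  obtain ⟨a, ha⟩ := hι.exists_desc _ (cS.compat.mono hxS)
  have sq : CommSq a l (colimOnMap D hST) (ιOn D T x hxT) := by
    refine ⟨hι.hom_ext fun y hy => ?_⟩
    rw [← Category.assoc, ha, ιOn_colimOnMap, ← Category.assoc, hl y hy]
    exact (cT.compat y x _ _ (le_of_lt hy)).symm
  have key (s : PushoutCocone a l) : ∃ g : colimOn D T ⟶ s.pt,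
      colimOnMap D hST ≫ g = s.inl ∧ ιOn D T x hxT ≫ g = s.inr := by
    -- The cocone over `T` uses `s.inl` on `S` and `s.inr` at the new element `x`. Compatibility
    -- between the two is `s.condition` precomposed with the coprojections `ι`.
    let f : ∀ y ∈ T, D.obj y ⟶ s.pt := fun y hy =>
      if h : y ∈ S then ιOn D S y h ≫ s.inl
      else eqToHom (by rw [(hT hy).resolve_right h]) ≫ s.inr
    have f₁ (y : P) (hy : y ∈ S) (hy' : y ∈ T) : f y hy' = ιOn D S y hy ≫ s.inl := dif_pos hy
    have f₂ (hx' : x ∈ T) : f x hx' = s.inr := by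
      simp [f, hx]
    have hf : CompatOn D T f := by
      intro y z hy hz hyz
      by_cases hz' : z ∈ S
      · rw [f₁ z hz' hz, f₁ y (hS hyz hz') hy, ← Category.assoc, cS.compat y z (hS hyz hz') hz' hyz]
      · obtain rfl := (hT hz).resolve_right hz'
        rcases hyz.eq_or_lt with rfl | hlt
        · exact (congrArg (· ≫ f y hz) (D.map_id y)).trans (Category.id_comp _)
        · have hlt' : y ∈ Set.Iio z := hlt
          have e₁ : D.map (homOfLE hyz) ≫ s.inr = (ι y hlt' ≫ l) ≫ s.inr :=
            congrArg (· ≫ s.inr) (hl y hlt').symm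
          have e₂ : (ι y hlt' ≫ a) ≫ s.inl = ιOn D S y (hxS hlt') ≫ s.inl :=
            congrArg (· ≫ s.inl) (ha y hlt')
          rw [f₂ hz, f₁ y (hxS hlt') hy, e₁, Category.assoc, ← s.condition, ← Category.assoc, e₂]
    obtain ⟨g, hg⟩ := cT.exists_desc f hf
    refine ⟨g, cS.hom_ext fun y hy => ?_, ?_⟩
    · rw [ιOn_colimOnMap_assoc, hg, f₁ y hy (hST hy)]
    · rw [hg, f₂ hxT]
  choose g hg₁ hg₂ using key
  refine ⟨a, sq, ⟨PushoutCocone.IsColimit.mk _ g hg₁ hg₂ fun s m hm₁ hm₂ => ?_⟩⟩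
  refine cT.hom_ext fun y hy => ?_
  by_cases h : y ∈ S
  · rw [← ιOn_colimOnMap D hST y h, Category.assoc, Category.assoc, hm₁, hg₁]
  · obtain rfl := (hT hy).resolve_right h
    rw [hm₂, hg₂]

end ColimOn

/-! ### Cofibrations and the comparison maps between lower sets. -/

section Cellular

variable {C : Type u} [Category.{v} C]

instance (X : MorphismProperty C) : (po X).IsStableUnderCobaseChange where
  of_isPushout {A A' B B' f g f' g'} sq hf := by
    rcases hf with hf | hf
    · exact Or.inl (MorphismProperty.of_isPushout sq hf)
    · exact Or.inr (MorphismProperty.of_isPushout sq hf)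

theorem isomorphisms_le_po (X : MorphismProperty C) : MorphismProperty.isomorphisms C ≤ po X :=
  le_sup_right

theorem po_le_llp_rlp (X : MorphismProperty C) : po X ≤ X.rlp.llp :=
  sup_le X.pushouts_le_llp_rlp fun _ _ f (_ : IsIso f) _ _ _ _ => inferInstance

/-- A class defined by a left lifting property is closed under pushouts, transfinite composites and
retracts. This is the only property of cofibrations needed to exhibit `K` as a retract. -/
theorem cof_le_llp_rlp (X : MorphismProperty C) : cof.{w} X ≤ X.rlp.llp :=
  (MorphismProperty.retracts_monotone ((MorphismProperty.transfiniteCompositions_monotone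
    (po_le_llp_rlp X)).trans (MorphismProperty.transfiniteCompositions_le _))).trans
    (MorphismProperty.retracts_le _)

variable {P : Type w} [PartialOrder P]

/-- The cocone with point `colim_T D` on the colimits of `D` over a chain of subsets of `T`. -/
noncomputable def chainCocone [HasColimitsOfSize.{w, w} C] (D : P ⥤ C)
    {J : Type w} [LinearOrder J] (A : J →o Set P) {T : Set P} (hT : ∀ j, A j ⊆ T) :
    Cocone (A.monotone.functor ⋙ colimOnFunctor D) where
  pt := colimOn D T
  ι :=
    { app := fun j => colimOnMap D (hT j)
      naturality := fun i j f => by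
        have h : A i ⊆ A j := A.monotone (leOfHom f)
        refine Eq.trans (b := colimOnMap D (hT i)) ?_ (Category.comp_id _).symm
        exact ((colimOnFunctor D).map_comp (homOfLE h) (homOfLE (hT j))).symm }

/-- The colimit of `D` over the union of a chain of subsets is the colimit of the colimits. -/
theorem nonempty_isColimit_chainCocone [HasColimitsOfSize.{w, w} C] (D : P ⥤ C)
    {J : Type w} [LinearOrder J] (A : J →o Set P) {T : Set P} (hT : ∀ j, A j ⊆ T)
    (hT' : ∀ x ∈ T, ∃ j, x ∈ A j) : Nonempty (IsColimit (chainCocone D A hT)) := by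
  have cT := isColimOn_colimOn D T
  have key (s : Cocone (A.monotone.functor ⋙ colimOnFunctor D)) :
      ∃ g : colimOn D T ⟶ s.pt, ∀ j, colimOnMap D (hT j) ≫ g = s.ι.app j := by
    let σ (j : J) : colimOn D (A j) ⟶ s.pt := s.ι.app j
    have aux (i j : J) (hij : i ≤ j) (x : P) (hx : x ∈ A i) :
        ιOn D (A i) x hx ≫ σ i = ιOn D (A j) x (A.monotone hij hx) ≫ σ j := by
      have h : colimOnMap D (A.monotone hij) ≫ σ j = σ i := s.w (homOfLE hij)
      rw [← h]
      exact ιOn_colimOnMap_assoc D (A.monotone hij) x hx _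
    have aux' (i j : J) (x : P) (hx : x ∈ A i) (hx' : x ∈ A j) :
        ιOn D (A i) x hx ≫ σ i = ιOn D (A j) x hx' ≫ σ j := by
      rcases le_total i j with h | h
      · exact aux i j h x hx
      · exact (aux j i h x hx').symm
    choose j hj using hT'
    obtain ⟨g, hg⟩ := cT.exists_desc (fun x hx => ιOn D (A (j x hx)) x (hj x hx) ≫ σ _) (by
      intro x y hx hy hxy
      have hx' := A.monotone (le_max_left (j x hx) (j y hy)) (hj x hx)
      have hy' := A.monotone (le_max_right (j x hx) (j y hy)) (hj y hy)
      beta_reduce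
      rw [aux' (j x hx) (max (j x hx) (j y hy)) x (hj x hx) hx',
        aux' (j y hy) (max (j x hx) (j y hy)) y (hj y hy) hy',
        ← Category.assoc, (isColimOn_colimOn D (A (max (j x hx) (j y hy)))).compat x y hx' hy' hxy])
    refine ⟨g, fun i => (isColimOn_colimOn D (A i)).hom_ext fun x hx => ?_⟩
    rw [ιOn_colimOnMap_assoc, hg]
    exact aux' _ _ _ _ _
  choose g hg using key
  exact ⟨{
    desc := g
    fac := hg
    uniq := fun s m hm => cT.hom_ext fun x hx => by
      obtain ⟨j, hj⟩ := hT' x hx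
      have h₁ : colimOnMap D (hT j) ≫ m = colimOnMap D (hT j) ≫ g s := (hm j).trans (hg s j).symm
      rw [← ιOn_colimOnMap D (hT j) x hj, Category.assoc, ← h₁]
      exact Category.assoc _ _ _ }⟩

/-- If the latching maps of `D` belong to `W`, then the comparison map between the colimits over
two lower sets is a transfinite composite of morphisms in `W`. -/
theorem transfiniteCompositions_colimOnMap [HasColimitsOfSize.{w, w} C] [WellFoundedLT P]
    {D : P ⥤ C} {W : MorphismProperty C} [W.IsStableUnderCobaseChange]
    (hW : MorphismProperty.isomorphisms C ≤ W) (hD : ∀ x, LatchingIn D W x)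
    {S T : Set P} (hS : IsLowerSet S) (hT : IsLowerSet T) (hST : S ⊆ T) :
    MorphismProperty.transfiniteCompositions.{w} W (colimOnMap D hST) := by
  -- The elements of `T` outside `S` are added one at a time along a well-ordered linear extension
  -- of `P`; the top element is adjoined so that some stage contains all of `T`.
  let J := WithTop (WellOrderExtension P)
  let ρ : P → J := fun x => (toWellOrderExtension x : WellOrderExtension P)
  have hρ : StrictMono ρ := WithTop.coe_strictMono.comp toWellOrderExtension_strictMono
  let _ : OrderBot J := WellFoundedLT.toOrderBot J
  let _ : SuccOrder J := SuccOrder.ofLinearWellFoundedLT J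
  have hρ' : Function.Injective ρ := WithTop.coe_injective.comp toWellOrderExtension.injective
  let A : J →o Set P :=
    { toFun := fun j => S ∪ {x | x ∈ T ∧ ρ x < j}
      monotone' := fun i j hij => Set.union_subset_union_right S
        fun x hx => ⟨hx.1, hx.2.trans_le hij⟩ }
  have hA (j : J) : A j ⊆ T := Set.union_subset hST fun x hx => hx.1
  have hA' (j : J) : IsLowerSet (A j) := by
    rintro x y hyx (hx | hx)
    · exact Or.inl (hS hyx hx)
    · exact Or.inr ⟨hT hyx hx.1, (hρ.monotone hyx).trans_lt hx.2⟩
  have hbot : A ⊥ = S := by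
    ext x
    exact ⟨fun hx => hx.elim id fun hx => (not_lt_bot hx.2).elim, Or.inl⟩
  let F : J ⥤ C := A.monotone.functor ⋙ colimOnFunctor D
  rw [MorphismProperty.transfiniteCompositions_iff]
  refine ⟨J, inferInstance, inferInstance, inferInstance, inferInstance, ⟨?_⟩⟩
  have hF : F.IsWellOrderContinuous := by
    refine ⟨fun m hm => ?_⟩
    refine nonempty_isColimit_chainCocone D (J := Set.Iio m)
      ⟨fun j => A j.1, fun i j hij => A.monotone hij⟩ (T := A m)
      (fun j => A.monotone (le_of_lt j.2)) ?_
    rintro x (hx | hx)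
    · exact ⟨⟨⊥, hm.bot_lt⟩, Or.inl hx⟩
    · exact ⟨⟨Order.succ (ρ x), hm.succ_lt hx.2⟩,
        Or.inr ⟨hx.1, Order.lt_succ_of_not_isMax (hx.2.not_isMax)⟩⟩
  have hc := nonempty_isColimit_chainCocone D A hA
    (fun x hx => ⟨⊤, Or.inr ⟨hx, WithTop.coe_lt_top _⟩⟩)
  exact
    { F := F
      isoBot := (colimOnFunctor D).mapIso (eqToIso hbot)
      incl := (chainCocone D A hA).ι
      isColimit := hc.some
      fac := (isColimOn_colimOn D S).hom_ext fun x hx => by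
        refine (ιOn_colimOnMap_assoc D hbot.symm.subset x hx _).trans ?_
        rw [ιOn_colimOnMap]
        exact ιOn_colimOnMap D (hA ⊥) x _
      map_mem := fun j hj => by
        change W (colimOnMap D (A.monotone (Order.le_succ j)))
        -- The successor step adds at most the element with `ρ x = j`: the map is an isomorphism if
        -- there is none, and otherwise a pushout of the latching map at `x`.
        by_cases h : A j = A (Order.succ j)
        · refine hW _ ?_
          exact inferInstanceAs (IsIso ((colimOnFunctor D).map (eqToIso h).hom))
        · obtain ⟨x, hx, hx'⟩ := Set.exists_of_ssubset
            (lt_of_le_of_ne (A.monotone (Order.le_succ j)) h)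
          have hxj : j ≤ ρ x := by
            refine le_of_not_gt fun hlt => ?_
            rcases hx with hx | hx
            · exact hx' (Or.inl hx)
            · exact hx' (Or.inr ⟨hx.1, hlt⟩)
          have hmem (y : P) (hy : y ∈ A (Order.succ j)) (hy' : y ∉ A j) : ρ y = j := by
            rcases hy with hy | hy
            · exact (hy' (Or.inl hy)).elim
            · refine le_antisymm (Order.le_of_lt_succ hy.2) ?_
              refine le_of_not_gt fun hlt => ?_
              exact hy' (Or.inr ⟨hy.1, hlt⟩)
          obtain ⟨M, ι, l, hι, hl, hl'⟩ := hD x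
          obtain ⟨a, ha⟩ := isPushout_colimOn_insert D (hA' j) hx'
            (fun y hy => by
              by_contra hy'
              have := hmem y (hA' _ (le_of_lt hy) hx) hy'
              rw [← hmem x hx hx'] at this
              exact hy.ne (hρ' this))
            (A.monotone (Order.le_succ j)) hx
            (fun y hy => by
              by_cases hy' : y ∈ A j
              · exact Or.inr hy'
              · exact Or.inl (hρ' ((hmem y hy hy').trans (hmem x hx hx').symm)))
            hι hl'
          exact MorphismProperty.of_isPushout ha hl }

end Cellular

/-! ### Recursive construction of diagrams on well-founded posets. -/

section StrictRecursion

variable {S : Type u} [Category.{v} S] {P : Type w} [PartialOrder P]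

/-- The family of arrows `a` is functorial at the composable pair `x ≤ y ≤ z`. -/
def IsFunctorialAt (a : P → P → Arrow S) (x y z : P) : Prop :=
  ∃ (X Y Z : S) (f : X ⟶ Y) (g : Y ⟶ Z), a x x = Arrow.mk (𝟙 X) ∧ a y y = Arrow.mk (𝟙 Y) ∧
    a z z = Arrow.mk (𝟙 Z) ∧ a x y = Arrow.mk f ∧ a y z = Arrow.mk g ∧ a x z = Arrow.mk (f ≫ g)

/-- A family of arrows which is functorial at all composable pairs comes from a functor. -/
theorem exists_functor_of_isFunctorialAt {a : P → P → Arrow S} {L : Set P}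
    (ha : ∀ x ∈ L, ∀ y ∈ L, ∀ z ∈ L, x ≤ y → y ≤ z → IsFunctorialAt a x y z) :
    ∃ Φ : L ⥤ S, ∀ (x y : L) (f : x ⟶ y), a x y = Arrow.mk (Φ.map f) := by
  have h (x y : L) (f : x ⟶ y) :
      ∃ g : (a x.1 x.1).left ⟶ (a y.1 y.1).left, a x y = Arrow.mk g := by
    obtain ⟨X, Y, Z, f, g, h₁, h₂, -, h₃, -, -⟩ :=
      ha x.1 x.2 y.1 y.2 y.1 y.2 (leOfHom f) le_rfl
    rw [h₁, h₂, h₃]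
    exact ⟨f, rfl⟩
  choose m hm using h
  refine ⟨{ obj := fun x => (a x.1 x.1).left, map := fun {x y} f => m x y f,
            map_id := fun x => ?_, map_comp := fun {x y z} p q => ?_ }, hm⟩
  · obtain ⟨X, Y, Z, f, g, h₁, h₂, -, h₃, -, -⟩ := ha x.1 x.2 x.1 x.2 x.1 x.2 le_rfl le_rfl
    have := hm x x (𝟙 x)
    generalize m x x (𝟙 x) = n at this ⊢
    revert n
    rw [h₁]
    intro n hn
    exact (Arrow.mk_injective _ _ hn).symm
  · obtain ⟨X, Y, Z, f, g, h₁, h₂, h₃, h₄, h₅, h₆⟩ :=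
      ha x.1 x.2 y.1 y.2 z.1 z.2 (leOfHom p) (leOfHom q)
    have e₁ := hm x y p
    have e₂ := hm y z q
    have e₃ := hm x z (p ≫ q)
    generalize m x y p = n₁ at e₁ ⊢
    generalize m y z q = n₂ at e₂ ⊢
    generalize m x z (p ≫ q) = n₃ at e₃ ⊢
    revert n₁ n₂ n₃
    rw [h₁, h₂, h₃, h₄, h₅, h₆]
    intro n₁ e₁ n₂ e₂ n₃ e₃
    rw [← Arrow.mk_injective _ _ e₁, ← Arrow.mk_injective _ _ e₂, ← Arrow.mk_injective _ _ e₃]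

theorem functor_ext_of_arrow {L : Type*} [Category L] {Φ Ψ : L ⥤ S}
    (h : ∀ (x y : L) (f : x ⟶ y), Arrow.mk (Φ.map f) = Arrow.mk (Ψ.map f)) : Φ = Ψ := by
  refine CategoryTheory.Functor.ext (fun x => congrArg Comma.left (h x x (𝟙 x))) fun x y f => ?_
  obtain ⟨hx, hy, e⟩ := (Arrow.mk_eq_mk_iff _ _).1 (h x y f)
  exact e

/-- A diagram on a well-founded poset can be constructed recursively, by choosing a cocone on
each of its restrictions to the subsets `{y | y < t}`. -/
theorem exists_strict_recursion [WellFoundedLT P] [Nonempty S]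
    (c : ∀ (t : P) (Φ : Set.Iio t ⥤ S), Cocone Φ) :
    ∃ D : P ⥤ S, ∀ t : P, ∃ e : (c t (restrictTo D (Set.Iio t))).pt ≅ D.obj t,
      ∀ (y : P) (hy : y ∈ Set.Iio t),
        (c t (restrictTo D (Set.Iio t))).ι.app ⟨y, hy⟩ ≫ e.hom =
          D.map (homOfLE (Set.mem_Iio.1 hy).le) := by
  classical
  let junk : Arrow S := Arrow.mk (𝟙 (Classical.arbitrary S))
  let IsF (a : P → P → Arrow S) (t : P) (Φ : Set.Iio t ⥤ S) : Prop :=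
    ∀ (x y : Set.Iio t) (f : x ⟶ y), a x y = Arrow.mk (Φ.map f)
  let col (t : P) (Φ : Set.Iio t ⥤ S) (x : P) : Arrow S :=
    if hx : x ∈ Set.Iio t then Arrow.mk ((c t Φ).ι.app ⟨x, hx⟩) else Arrow.mk (𝟙 (c t Φ).pt)
  -- The recursion defines the column of all arrows into `t`. Values in `Arrow S` allow it to run
  -- before functoriality is known; `junk` is returned if the earlier columns form no functor, which
  -- `hfun` excludes by induction.
  let step (t : P) (ih : ∀ s, s < t → P → Arrow S) : P → Arrow S :=
    if h : ∃ Φ, IsF (fun x y => if hy : y < t then ih y hy x else junk) t Φ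
    then col t h.choose else fun _ => junk
  let b : P → P → Arrow S := (wellFounded_lt (α := P)).fix step
  let a : P → P → Arrow S := fun x y => b y x
  have hb (t : P) : b t = step t fun s _ => b s := (wellFounded_lt (α := P)).fix_eq _ _
  have key (t : P) (h : ∃ Φ, IsF a t Φ) : ∃ Φ, IsF a t Φ ∧ ∀ x, a x t = col t Φ x := by
    have h' : ∃ Φ, IsF (fun x y => if hy : y < t then b y x else junk) t Φ := by
      obtain ⟨Φ, hΦ⟩ := h
      refine ⟨Φ, fun x y f => ?_⟩
      rw [← hΦ x y f]
      exact dif_pos (Set.mem_Iio.1 y.2)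
    refine ⟨h'.choose, fun x y f => ?_, fun x => ?_⟩
    · rw [← h'.choose_spec x y f]
      have e : (if hy : y.1 < t then b y.1 x.1 else junk) = b y.1 x.1 :=
        dif_pos (Set.mem_Iio.1 y.2)
      exact e.symm
    · change b t x = _
      rw [hb t]
      exact congrFun (dif_pos h') x
  have hfun (t : P) : ∀ x y, x ≤ y → y ≤ t → IsFunctorialAt a x y t := by
    induction t using (wellFounded_lt (α := P)).induction with
    | _ t ih =>
      obtain ⟨Φ, hΦ, hcol⟩ := key t (exists_functor_of_isFunctorialAt
        fun x _ y _ z hz hxy hyz => ih z hz x y hxy hyz)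
      have htt : a t t = Arrow.mk (𝟙 (c t Φ).pt) := (hcol t).trans (dif_neg (lt_irrefl t))
      have hxt (x : P) (hx : x ∈ Set.Iio t) : a x t = Arrow.mk ((c t Φ).ι.app ⟨x, hx⟩) :=
        (hcol x).trans (dif_pos hx)
      have hxx (x : P) (hx : x ∈ Set.Iio t) : a x x = Arrow.mk (𝟙 (Φ.obj ⟨x, hx⟩)) := by
        rw [hΦ ⟨x, hx⟩ ⟨x, hx⟩ (𝟙 _), Φ.map_id]
      intro x y hxy hyt
      rcases hyt.eq_or_lt with rfl | hyt
      · rcases hxy.eq_or_lt with rfl | hxy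
        · exact ⟨_, _, _, 𝟙 _, 𝟙 _, htt, htt, htt, htt, htt, by rw [Category.comp_id]; exact htt⟩
        · refine ⟨_, _, _, _, 𝟙 _, hxx x hxy, htt, htt, hxt x hxy, htt, ?_⟩
          rw [hxt x hxy]
          exact congrArg Arrow.mk (Category.comp_id _).symm
      · have hx : x ∈ Set.Iio t := hxy.trans_lt hyt
        refine ⟨_, _, _, _, _, hxx x hx, hxx y hyt, htt,
          hΦ ⟨x, hx⟩ ⟨y, hyt⟩ (homOfLE hxy), hxt y hyt, ?_⟩
        rw [hxt x hx]
        exact congrArg Arrow.mk ((c t Φ).w (homOfLE hxy : (⟨x, hx⟩ : Set.Iio t) ⟶ ⟨y, hyt⟩)).symm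
  obtain ⟨D', hD'⟩ := exists_functor_of_isFunctorialAt (a := a) (L := Set.univ)
    fun x _ y _ z _ hxy hyz => hfun z x y hxy hyz
  let D : P ⥤ S :=
    { obj := fun x => D'.obj ⟨x, trivial⟩
      map := fun {x y} f => D'.map (homOfLE (leOfHom f) : (⟨x, trivial⟩ : (Set.univ : Set P)) ⟶
        ⟨y, trivial⟩)
      map_id := fun x => D'.map_id _
      map_comp := fun _ _ => D'.map_comp _ _ }
  have hD (x y : P) (f : x ⟶ y) : a x y = Arrow.mk (D.map f) := hD' ⟨x, trivial⟩ ⟨y, trivial⟩ _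
  refine ⟨D, fun t => ?_⟩
  obtain ⟨Φ, hΦ, hcol⟩ := key t
    ⟨restrictTo D (Set.Iio t), fun x y f => hD x.1 y.1 (homOfLE (leOfHom f))⟩
  obtain rfl : Φ = restrictTo D (Set.Iio t) := functor_ext_of_arrow fun x y f => by
    rw [← hΦ x y f]
    exact hD x.1 y.1 (homOfLE (leOfHom f))
  have htt : Arrow.mk (𝟙 (D.obj t)) = Arrow.mk (𝟙 (c t (restrictTo D (Set.Iio t))).pt) := by
    rw [← D.map_id, ← hD t t (𝟙 t)]
    exact (hcol t).trans (dif_neg (lt_irrefl t))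
  have e : (c t (restrictTo D (Set.Iio t))).pt = D.obj t := (congrArg Comma.left htt).symm
  refine ⟨eqToIso e, fun y hy => ?_⟩
  have hy' : Arrow.mk (D.map (homOfLE (Set.mem_Iio.1 hy).le)) =
      Arrow.mk ((c t (restrictTo D (Set.Iio t))).ι.app ⟨y, hy⟩) := by
    rw [← hD y t _]
    exact (hcol y).trans (dif_pos hy)
  obtain ⟨h₁, h₂, h₃⟩ := (Arrow.mk_eq_mk_iff _ _).1 hy'
  exact (h₃.trans (Category.id_comp _)).symm

end StrictRecursion

/-! ### The fat small object argument. -/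

section SmallOver

variable {C : Type u} [Category.{v} C] {𝒢 : Type w}

/-- The morphisms to `K` from the members of a family `G` of objects. -/
structure SmallOver (G : 𝒢 → C) (K : C) where
  idx : 𝒢
  hom : G idx ⟶ K

variable {G : 𝒢 → C} {K : C}

@[simps]
instance : Category (SmallOver G K) where
  Hom s t := { f : G s.idx ⟶ G t.idx // f ≫ t.hom = s.hom }
  id s := ⟨𝟙 _, Category.id_comp _⟩
  comp f g := ⟨f.1 ≫ g.1, by rw [Category.assoc, g.2, f.2]⟩

/-- The source of a morphism to `K`. -/
@[simps]
def SmallOver.forget (G : 𝒢 → C) (K : C) : SmallOver G K ⥤ C where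
  obj s := G s.idx
  map f := f.1

/-- A lifting problem between a morphism `G i ⟶ G j` and a morphism to `K`, whose top morphism
is defined on `G i` with values in `G k`. -/
structure LiftingCode (G : 𝒢 → C) (K : C) where
  i : 𝒢
  j : 𝒢
  g : G i ⟶ G j
  k : 𝒢
  a : G i ⟶ G k
  b : G j ⟶ K

instance [LocallySmall.{w} C] : Small.{w} (LiftingCode G K) := by
  let f : LiftingCode G K → Σ (i : 𝒢) (j : 𝒢) (_ : G i ⟶ G j) (k : 𝒢) (_ : G i ⟶ G k), G j ⟶ K :=
    fun c => ⟨c.i, c.j, c.g, c.k, c.a, c.b⟩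
  refine small_of_injective (f := f) ?_
  rintro ⟨i, j, g, k, a, b⟩ ⟨i', j', g', k', a', b'⟩ h
  cases h
  rfl

/-- The cocone `c` is obtained by factoring the colimit of `Φ` as a morphism in `po X` which solves
the lifting problem `label` at the greatest index. -/
structure IsGoodStep (X : MorphismProperty C) {I : Type w} [PartialOrder I]
    (Φ : I ⥤ SmallOver G K) (label : Option (LiftingCode G K)) (c : Cocone Φ) : Prop where
  exists_latching : ∃ (cc : Cocone (Φ ⋙ SmallOver.forget G K)) (l : cc.pt ⟶ G c.pt.idx),
    Nonempty (IsColimit cc) ∧ po X l ∧ ∀ y, cc.ι.app y ≫ l = (c.ι.app y).1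
  exists_lift : ∀ (x : I), (∀ y, y ≤ x) → ∀ (i j : 𝒢) (g : G i ⟶ G j)
    (a : G i ⟶ G (Φ.obj x).idx) (b : G j ⟶ K), po X g → a ≫ (Φ.obj x).hom = g ≫ b →
    label = some ⟨i, j, g, _, a, b⟩ →
      ∃ l : G j ⟶ G c.pt.idx, g ≫ l = a ≫ (c.ι.app x).1 ∧ l ≫ c.pt.hom = b

/-- If the label is a lifting problem posed at the greatest index, push out its left side `g` along
the top map continued to `colim Φ`; otherwise take the identity of `colim Φ`. The resulting object
is a colimit of fewer than `κ` presentable objects, hence isomorphic to a member of the family `G`.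
-/
theorem exists_isGoodStep [LocallySmall.{w} C] [HasColimitsOfSize.{w, w} C]
    {κ : Cardinal.{w}} [Fact κ.IsRegular]
    (hG : ∀ i, IsCardinalPresentable (G i) κ)
    (hG' : ∀ Z : C, IsCardinalPresentable Z κ → ∃ i, Nonempty (Z ≅ G i))
    (X : MorphismProperty C) {I : Type w} [PartialOrder I] (hI : #I < κ)
    (Φ : I ⥤ SmallOver G K) (label : Option (LiftingCode G K)) :
    ∃ c : Cocone Φ, IsGoodStep X Φ label c := by
  have : HasPushouts C := (hasFiniteColimits_of_hasColimitsOfSize.{w, w} C).out _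
  let cc := colimit.cocone (Φ ⋙ SmallOver.forget G K)
  let hcc : IsColimit cc := colimit.isColimit _
  have hM : IsCardinalPresentable cc.pt κ := by
    have : ∀ k, IsCardinalPresentable ((Φ ⋙ SmallOver.forget G K).obj k) κ := fun k => hG _
    exact isCardinalPresentable_of_isColimit _ hcc κ (hasCardinalLT_arrow_of_mk_lt hI)
  let s : Cocone (Φ ⋙ SmallOver.forget G K) :=
    { pt := K
      ι := { app := fun y => (Φ.obj y).hom
             naturality := fun y z f => (Φ.map f).2.trans (Category.comp_id _).symm } }
  let q : cc.pt ⟶ K := hcc.desc s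
  let σ (y : I) : G (Φ.obj y).idx ⟶ cc.pt := cc.ι.app y
  have hq (y : I) : σ y ≫ q = (Φ.obj y).hom := hcc.fac s y
  have key (M' : C) (hM' : IsCardinalPresentable M' κ) (l : cc.pt ⟶ M') (hl : po X l)
      (q' : M' ⟶ K) (hq' : l ≫ q' = q) :
      ∃ (c : Cocone Φ) (e : M' ⟶ G c.pt.idx),
        (∃ (cc : Cocone (Φ ⋙ SmallOver.forget G K)) (l : cc.pt ⟶ G c.pt.idx),
          Nonempty (IsColimit cc) ∧ po X l ∧ ∀ y, cc.ι.app y ≫ l = (c.ι.app y).1) ∧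
        e ≫ c.pt.hom = q' ∧ ∀ y, (c.ι.app y).1 = (σ y ≫ l) ≫ e := by
    obtain ⟨k, ⟨e⟩⟩ := hG' M' hM'
    let c : Cocone Φ :=
      { pt := ⟨k, e.inv ≫ q'⟩
        ι := { app := fun y => ⟨(σ y ≫ l) ≫ e.hom, by
                 have : ((σ y ≫ l) ≫ e.hom) ≫ e.inv ≫ q' = (Φ.obj y).hom := by
                   rw [Category.assoc, e.hom_inv_id_assoc, Category.assoc, hq', hq]
                 exact this⟩
               naturality := fun y z f => Subtype.ext (by
                 have := cc.w f
                 refine Eq.trans ?_ (Category.comp_id _).symm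
                 exact (Category.assoc _ _ _).symm.trans (congrArg (· ≫ e.hom)
                   ((Category.assoc _ _ _).symm.trans (congrArg (· ≫ l) this)))) } }
    exact ⟨c, e.hom, ⟨cc, l ≫ e.hom, ⟨hcc⟩, MorphismProperty.RespectsIso.postcomp _ _ _ hl,
      fun y => (Category.assoc _ _ _).symm⟩, e.hom_inv_id_assoc _, fun y => rfl⟩
  by_cases h : ∃ (x : I) (_ : ∀ y, y ≤ x) (i j : 𝒢) (g : G i ⟶ G j)
      (a : G i ⟶ G (Φ.obj x).idx) (b : G j ⟶ K), po X g ∧ a ≫ (Φ.obj x).hom = g ≫ b ∧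
      label = some ⟨i, j, g, _, a, b⟩
  · obtain ⟨x, hx, i, j, g, a, b, hg, hab, hlabel⟩ := h
    let a' : G i ⟶ cc.pt := a ≫ σ x
    have ha' : a' ≫ q = g ≫ b := by
      rw [← hab, ← hq x, Category.assoc]
    have sq := IsPushout.of_hasPushout a' g
    have hM' : IsCardinalPresentable (pushout a' g) κ := by
      have : ∀ k, IsCardinalPresentable ((span a' g).obj k) κ := by
        rintro (_ | _ | _)
        · exact hG i
        · exact hM
        · exact hG j
      refine isCardinalPresentable_of_isColimit _ (colimit.isColimit (span a' g)) κ ?_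
      exact HasCardinalLT.of_le (hasCardinalLT_of_finite _ ℵ₀ le_rfl)
        (Fact.out : κ.IsRegular).aleph0_le
    obtain ⟨c, e, hc, he, hι⟩ := key _ hM' (pushout.inl a' g)
      (MorphismProperty.of_isPushout sq hg) (pushout.desc q b ha') (pushout.inl_desc _ _ _)
    refine ⟨c, hc, fun x' hx' i' j' g' a₁ b₁ hg' hab' hlabel' => ?_⟩
    obtain rfl := le_antisymm (hx' x) (hx x')
    rw [hlabel] at hlabel'
    simp only [Option.some.injEq, LiftingCode.mk.injEq] at hlabel'
    obtain ⟨rfl, rfl, hg₁, -, ha₁, hb₁⟩ := hlabel'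
    obtain rfl := eq_of_heq hg₁
    obtain rfl := eq_of_heq ha₁
    obtain rfl := eq_of_heq hb₁
    refine ⟨pushout.inr a' g ≫ e, ?_, ?_⟩
    · refine Eq.trans ?_ (congrArg (a ≫ ·) (hι x)).symm
      rw [← Category.assoc, ← pushout.condition]
      simp only [a', Category.assoc]
    · rw [Category.assoc, he, pushout.inr_desc]
  · obtain ⟨c, e, hc, he, hι⟩ := key _ hM (𝟙 _)
      (isomorphisms_le_po X _ (inferInstance : IsIso (𝟙 cc.pt))) q (Category.id_comp _)
    exact ⟨c, hc, fun x hx i j g a b hg hab hlabel =>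
      (h ⟨x, hx, i, j, g, a, b, hg, hab, hlabel⟩).elim⟩

end SmallOver

/-- A fat version of the small object argument. -/
theorem exists_fat_small_object {C : Type u} [Category.{v} C] {κ : Cardinal.{w}} [Fact κ.IsRegular]
    (hκ : ℵ₀ < κ) [IsCardinalLocallyPresentable C κ] {X : MorphismProperty C}
    (hX : X ≤ betweenPresentable C κ) (K : C) :
    ∃ (P : Type w) (_ : PartialOrder P) (D : P ⥤ C) (p : ∀ x, D.obj x ⟶ K),
      WellFoundedLT P ∧ (∀ x : P, #(Set.Iic x) < κ) ∧ IsDirectedPoset κ P ∧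
      (∀ x, IsCardinalPresentable (D.obj x) κ) ∧
      (∀ (x y : P) (h : x ≤ y), D.map (homOfLE h) ≫ p y = p x) ∧
      (∀ x, LatchingIn D (po X) x) ∧
      ∀ (A B : C) (g : A ⟶ B) (_ : X g) (x : P) (a : A ⟶ D.obj x) (b : B ⟶ K),
        a ≫ p x = g ≫ b → ∃ (y : P) (h : x ≤ y) (l : B ⟶ D.obj y),
          g ≫ l = a ≫ D.map (homOfLE h) ∧ l ≫ p y = b := by
  obtain ⟨Q, _, hQ, hQ'⟩ :=
    ObjectProperty.EssentiallySmall.exists_small_le.{w} (isCardinalPresentable C κ)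
  let 𝒢 : Type w := Shrink.{w} (Subtype Q)
  let G : 𝒢 → C := fun i => ((equivShrink _).symm i).1
  have hG (i : 𝒢) : IsCardinalPresentable (G i) κ := hQ _ ((equivShrink _).symm i).2
  have hG' (Z : C) (hZ : IsCardinalPresentable Z κ) : ∃ i, Nonempty (Z ≅ G i) := by
    obtain ⟨Y, hY, ⟨e⟩⟩ := hQ' Z hZ
    refine ⟨equivShrink _ ⟨Y, hY⟩, ⟨e ≪≫ eqToIso ?_⟩⟩
    simp [G]
  let Λ : Type w := Option (Shrink.{w} (LiftingCode G K))
  let P : Type w := Tree Λ κ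
  let code (t : P) : Option (LiftingCode G K) := t.label.map (equivShrink _).symm
  have hIic (t : P) : #(Set.Iic t) < κ := Tree.mk_Iic_lt Fact.out hκ t
  have hIio (t : P) : #(Set.Iio t) < κ :=
    (mk_le_mk_of_subset Set.Iio_subset_Iic_self).trans_lt (hIic t)
  choose c hc using fun (t : P) (Φ : Set.Iio t ⥤ SmallOver G K) =>
    exists_isGoodStep hG hG' X (hIio t) Φ (code t)
  have hwf : WellFoundedLT P := ⟨Tree.wellFounded_lt⟩
  -- The initial object is `κ`-presentable, so it provides the default value that the recursion
  -- requires.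
  have : Nonempty (SmallOver G K) := by
    have : HasInitial C := (hasFiniteColimits_of_hasColimitsOfSize.{w, w} C).out _
    have h : IsCardinalPresentable (⊥_ C) κ := by
      have : ∀ k, IsCardinalPresentable ((Functor.empty.{0} C).obj k) κ := fun k => k.as.elim
      refine isCardinalPresentable_of_isColimit _ (colimit.isColimit (Functor.empty.{0} C)) κ ?_
      exact HasCardinalLT.of_le (hasCardinalLT_of_finite _ ℵ₀ le_rfl) hκ.le
    obtain ⟨i, ⟨e⟩⟩ := hG' (⊥_ C) h
    exact ⟨⟨i, e.inv ≫ initial.to K⟩⟩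
  obtain ⟨D, hD⟩ := exists_strict_recursion c
  refine ⟨P, inferInstance, D ⋙ SmallOver.forget G K, fun x => (D.obj x).hom, hwf, hIic,
    Tree.isDirectedPoset, fun x => hG _, fun x y h => (D.map (homOfLE h)).2, fun x => ?_, ?_⟩
  · obtain ⟨e, he⟩ := hD x
    obtain ⟨cc, l, ⟨hcc⟩, hl, hl'⟩ := (hc x (restrictTo D (Set.Iio x))).exists_latching
    refine ⟨cc.pt, fun y hy => cc.ι.app ⟨y, hy⟩, l ≫ e.hom.1,
      isColimOn_of_isColimit (D := D ⋙ SmallOver.forget G K) (c := cc) hcc, ?_, fun y hy => ?_⟩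
    · have : IsIso e.hom.1 :=
        ⟨e.inv.1, congrArg Subtype.val e.hom_inv_id, congrArg Subtype.val e.inv_hom_id⟩
      exact MorphismProperty.RespectsIso.postcomp _ e.hom.1 _ hl
    · refine (Category.assoc _ _ _).symm.trans ((congrArg (· ≫ e.hom.1) (hl' ⟨y, hy⟩)).trans ?_)
      exact congrArg Subtype.val (he y hy)
  · intro A B g hg x a b hab
    obtain ⟨i, ⟨eA⟩⟩ := hG' A (hX _ hg).1
    obtain ⟨j, ⟨eB⟩⟩ := hG' B (hX _ hg).2
    let g' : G i ⟶ G j := eA.inv ≫ g ≫ eB.hom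
    have hg' : po X g' := by
      have hg₀ : po X g := Or.inl (MorphismProperty.le_pushouts _ _ hg)
      exact MorphismProperty.RespectsIso.precomp _ _ _
        (MorphismProperty.RespectsIso.postcomp _ _ _ hg₀)
    -- The node `t` has `x` as its only child and the lifting problem as its label. Thus `x` is
    -- greatest below `t`, and the step at `t` solves this very problem.
    obtain ⟨t, ht, hts⟩ := Tree.exists_node (κ := κ)
      (some (equivShrink _ ⟨i, j, g', (D.obj x).idx, eA.inv ≫ a, eB.inv ≫ b⟩) : Λ) {x}
      (by rw [mk_singleton]; exact one_lt_aleph0.trans hκ)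
    have htx (y : P) : y ∈ Set.Iio t ↔ y ≤ x := by
      rw [Set.mem_Iio, Tree.lt_iff, hts]
      simp
    have hx : x ∈ Set.Iio t := (htx x).2 le_rfl
    obtain ⟨e, he⟩ := hD t
    obtain ⟨l, hl, hl'⟩ := (hc t (restrictTo D (Set.Iio t))).exists_lift ⟨x, hx⟩
      (fun y => (htx y.1).1 y.2) i j g' (eA.inv ≫ a) (eB.inv ≫ b) hg' (by
        refine (Category.assoc _ _ _).trans ?_
        refine (congrArg (eA.inv ≫ ·) hab).trans ?_
        simp [g']) (by simp [code, ht])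
    refine ⟨t, (Set.mem_Iio.1 hx).le, eB.hom ≫ l ≫ e.hom.1, ?_, ?_⟩
    · have h₁ : g ≫ eB.hom = eA.hom ≫ g' := by simp [g']
      let σ : G (D.obj x).idx ⟶ G (c t (restrictTo D (Set.Iio t))).pt.idx :=
        ((c t (restrictTo D (Set.Iio t))).ι.app ⟨x, hx⟩).1
      have h₂ : σ ≫ e.hom.1 = (D.map (homOfLE (Set.mem_Iio.1 hx).le)).1 :=
        congrArg Subtype.val (he x hx)
      let a₀ : A ⟶ G (D.obj x).idx := a
      have hl₀ : g' ≫ l = (eA.inv ≫ a₀) ≫ σ := hl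
      calc g ≫ eB.hom ≫ l ≫ e.hom.1 = eA.hom ≫ (g' ≫ l) ≫ e.hom.1 := by
            rw [← Category.assoc, h₁]
            simp only [Category.assoc]
        _ = a₀ ≫ σ ≫ e.hom.1 := by
            rw [hl₀, Category.assoc, Category.assoc, eA.hom_inv_id_assoc]
        _ = _ := congrArg (a₀ ≫ ·) h₂
    · have h₁ : e.hom.1 ≫ (D.obj t).hom = (c t (restrictTo D (Set.Iio t))).pt.hom := e.hom.2
      have h₂ : (eB.hom ≫ l ≫ e.hom.1) ≫ (D.obj t).hom = b := by
        rw [Category.assoc, Category.assoc, h₁, hl', eB.hom_inv_id_assoc]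
      exact h₂

/-! ### The retract onto a cofibrant object, and filtrations by closed subsets. -/

variable {C : Type u} [Category.{v} C] {P : Type w} [PartialOrder P] {κ : Cardinal.{w}}
  [Fact κ.IsRegular]

theorem IsDirectedPoset.isCardinalFiltered_univ (hP : IsDirectedPoset κ P) :
    IsCardinalFiltered (Set.univ : Set P) κ :=
  isCardinalFiltered_preorder _ _ fun K s hK => by
    obtain ⟨j, hj⟩ := hP (Set.range fun k => (s k).1) (mk_range_le.trans_lt hK)
    exact ⟨⟨j, trivial⟩, fun k => hj ⟨k, rfl⟩⟩

theorem exists_hom_of_colimOn_univ [HasColimitsOfSize.{w, w} C] (hP : IsDirectedPoset κ P)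
    (D : P ⥤ C) {A : C} [IsCardinalPresentable A κ] (f : A ⟶ colimOn D Set.univ) (x₀ : P) :
    ∃ (x : P) (_ : x₀ ≤ x) (f' : A ⟶ D.obj x), f' ≫ ιOn D Set.univ x (Set.mem_univ _) = f := by
  have := hP.isCardinalFiltered_univ
  have hc := isColimOn_colimOn D Set.univ
  obtain ⟨⟨x, hx⟩, (f' : A ⟶ D.obj x), (hf' : f' ≫ ιOn D Set.univ x hx = f)⟩ :=
    IsCardinalPresentable.exists_hom_of_isColimit κ hc.nonempty_isColimit.some f
  obtain ⟨y, hy⟩ := hP {x₀, x} (((Set.toFinite _).lt_aleph0).trans_le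
    (Fact.out : κ.IsRegular).aleph0_le)
  have hxy : x ≤ y := hy (by simp)
  refine ⟨y, hy (by simp), f' ≫ D.map (homOfLE hxy), ?_⟩
  rw [Category.assoc, hc.compat x y hx, hf']

theorem exists_eq_of_colimOn_univ [HasColimitsOfSize.{w, w} C] (hP : IsDirectedPoset κ P)
    (D : P ⥤ C) {A : C} [IsCardinalPresentable A κ] {x y : P} (f : A ⟶ D.obj x)
    (g : A ⟶ D.obj y)
    (hfg : f ≫ ιOn D Set.univ x (Set.mem_univ _) = g ≫ ιOn D Set.univ y (Set.mem_univ _)) :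
    ∃ (z : P) (hx : x ≤ z) (hy : y ≤ z), f ≫ D.map (homOfLE hx) = g ≫ D.map (homOfLE hy) := by
  have := hP.isCardinalFiltered_univ
  obtain ⟨z, u, v, h⟩ := IsCardinalPresentable.exists_eq_of_isColimit κ
    (isColimOn_colimOn D Set.univ).nonempty_isColimit.some (i₁ := ⟨x, trivial⟩)
    (i₂ := ⟨y, trivial⟩) f g hfg
  exact ⟨z.1, leOfHom u, leOfHom v, h⟩

/-- If all lifting problems against morphisms in `X` can be solved along the diagram `D`, then
every `X`-cofibrant object `K` is a retract of the colimit of `D`. -/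
theorem exists_section_of_isCofibrantObject [HasColimitsOfSize.{w, w} C] {X : MorphismProperty C}
    (hX : X ≤ betweenPresentable C κ) {K : C} (hK : IsCofibrantObject.{w} X K)
    (hP : IsDirectedPoset κ P) {D : P ⥤ C} {p : ∀ x, D.obj x ⟶ K}
    (hp : ∀ (x y : P) (h : x ≤ y), D.map (homOfLE h) ≫ p y = p x)
    (hlift : ∀ (A B : C) (g : A ⟶ B) (_ : X g) (x : P) (a : A ⟶ D.obj x) (b : B ⟶ K),
        a ≫ p x = g ≫ b → ∃ (y : P) (h : x ≤ y) (l : B ⟶ D.obj y),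
          g ≫ l = a ≫ D.map (homOfLE h) ∧ l ≫ p y = b) :
    ∃ (q : colimOn D Set.univ ⟶ K) (s : K ⟶ colimOn D Set.univ), s ≫ q = 𝟙 K := by
  have hc := isColimOn_colimOn D Set.univ
  obtain ⟨q, hq⟩ := hc.exists_desc (fun x _ => p x) (fun x y _ _ h => hp x y h)
  have hrlp : X.rlp q := by
    intro A B g hg
    refine ⟨fun {a b} sq => ?_⟩
    have := (hX _ hg).1
    obtain ⟨x₀, -⟩ := hP ∅ (by
      rw [mk_eq_zero]
      exact (Fact.out : κ.IsRegular).pos)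
    obtain ⟨x, -, a', rfl⟩ := exists_hom_of_colimOn_univ hP D a x₀
    have sq' := sq.w
    rw [Category.assoc, hq] at sq'
    obtain ⟨y, hxy, l, hl, hl'⟩ := hlift A B g hg x a' b sq'
    refine ⟨⟨⟨l ≫ ιOn D Set.univ y (Set.mem_univ _), ?_, ?_⟩⟩⟩
    · rw [← Category.assoc, hl, Category.assoc, hc.compat]
    · rw [Category.assoc, hq, hl']
  obtain ⟨I, hI, h⟩ := hK
  have : HasLiftingProperty (hI.to K) q := cof_le_llp_rlp X _ h q hrlp
  -- Lifting `0 ⟶ K` against `q` over the identity of `K` produces the section.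
  have sq : CommSq (hI.to _) (hI.to K) q (𝟙 K) := ⟨hI.hom_ext _ _⟩
  exact ⟨q, sq.lift, sq.fac_right⟩

/-- An endomorphism of a `κ`-directed colimit of `κ`-presentable objects restricts to the
colimits over all subsets which are closed under a suitable relation. -/
theorem exists_relation_of_idempotent [HasColimitsOfSize.{w, w} C] (hκ : ℵ₀ < κ)
    (hP : IsDirectedPoset κ P) (hP' : ∀ x : P, #(Set.Iic x) < κ) {D : P ⥤ C}
    (hD : ∀ x, IsCardinalPresentable (D.obj x) κ)
    (e : colimOn D Set.univ ⟶ colimOn D Set.univ) (he : e ≫ e = e) :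
    ∃ (r : P → P → Prop) (φ : P → P) (f : ∀ x, D.obj x ⟶ D.obj (φ x)),
      (∀ x, #{y | r x y} < κ) ∧ (∀ x y, y ≤ x → r x y) ∧ (∀ x, r x (φ x)) ∧
      (∀ x, f x ≫ ιOn D Set.univ (φ x) (Set.mem_univ _) = ιOn D Set.univ x (Set.mem_univ _) ≫ e) ∧
      (∀ x y (h : y ≤ x), ∃ (z : P) (_ : r x z) (h₁ : φ x ≤ z) (h₂ : φ y ≤ z),
        D.map (homOfLE h) ≫ f x ≫ D.map (homOfLE h₁) = f y ≫ D.map (homOfLE h₂)) ∧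
      (∀ x, ∃ (z : P) (_ : r x z) (h₁ : φ x ≤ z) (h₂ : φ (φ x) ≤ z),
        f x ≫ D.map (homOfLE h₁) = f x ≫ f (φ x) ≫ D.map (homOfLE h₂)) := by
  have hκ' : κ.IsRegular := Fact.out
  have hc := isColimOn_colimOn D Set.univ
  choose φ hφ f hf using fun x => exists_hom_of_colimOn_univ hP D
    (ιOn D Set.univ x (Set.mem_univ _) ≫ e) x
  have h₁ (x y : P) (h : y ≤ x) : ∃ (z : P) (h₁ : φ x ≤ z) (h₂ : φ y ≤ z),
      (D.map (homOfLE h) ≫ f x) ≫ D.map (homOfLE h₁) = f y ≫ D.map (homOfLE h₂) := by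
    refine exists_eq_of_colimOn_univ hP D _ _ ?_
    rw [Category.assoc, hf, hf, ← Category.assoc, hc.compat]
  have h₂ (x : P) : ∃ (z : P) (h₁ : φ x ≤ z) (h₂ : φ (φ x) ≤ z),
      f x ≫ D.map (homOfLE h₁) = (f x ≫ f (φ x)) ≫ D.map (homOfLE h₂) := by
    refine exists_eq_of_colimOn_univ hP D _ _ ?_
    rw [Category.assoc, hf, hf, ← Category.assoc, hf, Category.assoc, he]
  choose z₁ a₁ b₁ c₁ using h₁
  choose z₂ a₂ b₂ c₂ using h₂
  -- An `r`-closed set is a lower set, is stable under `φ`, and contains the stages `z₁`, `z₂` at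
  -- which the maps `f` become natural and idempotent. Each value set is small because `Set.Iic x`
  -- is.
  let r (x y : P) : Prop :=
    y ∈ Set.Iic x ∪ (Set.range (fun t : Set.Iic x => z₁ x t.1 t.2) ∪ {φ x, z₂ x})
  refine ⟨r, φ, f, fun x => ?_, fun x y h => Or.inl h, fun x => Or.inr (Or.inr (Or.inl rfl)), hf,
    fun x y h => ⟨z₁ x y h, Or.inr (Or.inl ⟨⟨y, h⟩, rfl⟩), a₁ x y h, b₁ x y h, ?_⟩,
    fun x => ⟨z₂ x, Or.inr (Or.inr (Or.inr rfl)), a₂ x, b₂ x, ?_⟩⟩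
  · change #↥(Set.Iic x ∪ (Set.range (fun t : Set.Iic x => z₁ x t.1 t.2) ∪ {φ x, z₂ x})) < κ
    refine (mk_union_le _ _).trans_lt (add_lt_of_lt hκ'.aleph0_le (hP' x) ?_)
    refine (mk_union_le _ _).trans_lt (add_lt_of_lt hκ'.aleph0_le
      (mk_range_le.trans_lt (hP' x)) ?_)
    exact ((Set.toFinite _).lt_aleph0).trans hκ
  · rw [← c₁ x y h, Category.assoc]
  · rw [c₂ x, Category.assoc]

/-- Given a relation `r` with fewer than `κ` values at each point, a set can be filtered by
`r`-closed subsets of cardinality less than `κ`, indexed by a `κ`-good `κ`-directed poset. -/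
theorem exists_good_filtration {P : Type w} {κ : Cardinal.{w}} (hκ : κ.IsRegular) (hκ' : ℵ₀ < κ)
    {r : P → P → Prop} (hr : ∀ x, #{y | r x y} < κ) :
    ∃ (Q : Type w) (_ : PartialOrder Q) (μ : P → Q), IsGoodPoset κ Q ∧ IsDirectedPoset κ Q ∧
      (∀ x y, r x y → μ y ≤ μ x) ∧ (∀ q, #{x | μ x ≤ q} < κ) ∧
      ∀ x, ∃ y, IsPredecessor y (μ x) := by
  classical
  let cl (x : P) : Set P := {y | Relation.ReflTransGen r x y}
  have hcl (x : P) : #(cl x) < κ := mk_reflTransGen_lt hκ hκ' hr x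
  have hself (x : P) : x ∈ cl x := Relation.ReflTransGen.refl
  let lt : P → P → Prop := WellOrderingRel
  have hwf : WellFounded lt := IsWellFounded.wf
  -- `m z` is the earliest point, in a well-ordering of `P`, whose closure contains `z`. Any `z ∈ cl
  -- j` has `m z` no later than `j`, so `ρ` is well-founded, and it has fewer than `κ` predecessors
  -- at `j` since `cl j` is small.
  let m (z : P) : P := hwf.min {y | z ∈ cl y} ⟨z, hself z⟩
  have hm (z : P) : z ∈ cl (m z) := hwf.min_mem {y | z ∈ cl y} _
  have hm' (z y : P) (h : z ∈ cl y) : ¬ lt y (m z) := hwf.not_lt_min {y | z ∈ cl y} h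
  let ρ (i j : P) : Prop := i ≠ j ∧ ∃ z ∈ cl j, m z = i
  have hρ : WellFounded ρ := Subrelation.wf (fun {i j} h => by
    obtain ⟨hij, z, hz, rfl⟩ := h
    rcases trichotomous_of lt (m z) j with h | h | h
    · exact h
    · exact (hij h).elim
    · exact (hm' z j hz h).elim) hwf
  have hρ' (j : P) : #{i | ρ i j} < κ := by
    refine (mk_le_mk_of_subset (t := m '' cl j) ?_).trans_lt (mk_image_le.trans_lt (hcl j))
    rintro i ⟨-, z, hz, rfl⟩
    exact ⟨z, hz, rfl⟩
  obtain ⟨Q, _, ν, hQ, hQ', hν, hν', hpred⟩ := exists_isGoodPoset hκ hκ' hρ hρ'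
  refine ⟨Q, inferInstance, fun x => ν (m x), hQ, hQ', fun x y h => ?_, fun q => ?_,
    fun x => hpred _⟩
  · by_cases h' : m y = m x
    · exact (congrArg ν h').le
    · exact hν' _ _ ⟨h', y, (hm x).tail h, rfl⟩
  · have h₁ : #(ν ⁻¹' Set.Iic q) < κ :=
      (mk_preimage_of_injective _ _ hν).trans_lt (hQ.card_Iic_lt q)
    have h₂ : {x | ν (m x) ≤ q} ⊆ ⋃ j : ν ⁻¹' Set.Iic q, cl j.1 := fun x hx =>
      Set.mem_iUnion.2 ⟨⟨m x, hx⟩, hm x⟩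
    refine (mk_le_mk_of_subset h₂).trans_lt (mk_iUnion_le_sum_mk.trans_lt ?_)
    exact sum_lt_of_isRegular hκ h₁ fun j => hcl j.1

/-! ### Splitting the idempotent over all closed subsets. -/

section Splitting

variable {C : Type u} [Category.{v} C]

/-- An idempotent splits through its coequalizer with the identity; passing to the opposite category
turns this into the equalizer criterion. -/
theorem isIdempotentComplete_of_hasColimitsOfSize [HasColimitsOfSize.{w, w} C] :
    IsIdempotentComplete C := by
  have : HasCoequalizers C := (hasFiniteColimits_of_hasColimitsOfSize.{w, w} C).out _
  refine Idempotents.isIdempotentComplete_of_isIdempotentComplete_opposite ?_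
  rw [Idempotents.isIdempotentComplete_iff_hasEqualizer_of_id_and_idempotent]
  intro X p hp
  infer_instance

/-- The subsets of `P` which are closed under the relation `r`. -/
abbrev ClosedSubset {P : Type w} (r : P → P → Prop) : Type w :=
  {S : Set P // ∀ x ∈ S, ∀ y, r x y → y ∈ S}

variable {P : Type w} [PartialOrder P]

/-- The functor `S ↦ colim_S D` on closed subsets. -/
noncomputable abbrev colimOnClosed [HasColimitsOfSize.{w, w} C] (D : P ⥤ C) (r : P → P → Prop) :
    ClosedSubset r ⥤ C :=
  (Subtype.mono_coe _).functor ⋙ colimOnFunctor D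

/-- A retract of the colimit of a `κ`-directed diagram of `κ`-presentable objects extends to a
retract of the functor `S ↦ colim_S D` on suitably closed subsets. -/
theorem exists_retract_functor [HasColimitsOfSize.{w, w} C] {κ : Cardinal.{w}} [Fact κ.IsRegular]
    (hκ : ℵ₀ < κ) (hP : IsDirectedPoset κ P) (hP' : ∀ x : P, #(Set.Iic x) < κ) {D : P ⥤ C}
    (hD : ∀ x, IsCardinalPresentable (D.obj x) κ)
    {K : C} {q : colimOn D Set.univ ⟶ K} {s : K ⟶ colimOn D Set.univ} (hs : s ≫ q = 𝟙 K) :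
    ∃ (r : P → P → Prop) (H : ClosedSubset r ⥤ C), (∀ x, #{y | r x y} < κ) ∧
      (∀ x y, y ≤ x → r x y) ∧ Nonempty (Retract H (colimOnClosed D r)) ∧
      Nonempty (H.obj ⟨Set.univ, fun _ _ _ _ => trivial⟩ ≅ K) := by
  obtain ⟨r, φ, f, hr, hr', hφ, hf, hnat, hidem⟩ := exists_relation_of_idempotent hκ hP hP' hD
    (q ≫ s) (by rw [Category.assoc, reassoc_of% hs])
  have hcompat (S : ClosedSubset r) : CompatOn D S.1
      (fun x hx => f x ≫ ιOn D S.1 (φ x) (S.2 x hx _ (hφ x))) := by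
    intro y x hy hx h
    obtain ⟨z, hz, h₁, h₂, e⟩ := hnat x y h
    have hzS : z ∈ S.1 := S.2 x hx _ hz
    have c := (isColimOn_colimOn D S.1).compat
    change D.map (homOfLE h) ≫ f x ≫ ιOn D S.1 (φ x) (S.2 x hx _ (hφ x)) =
      f y ≫ ιOn D S.1 (φ y) (S.2 y hy _ (hφ y))
    rw [← c (φ x) z (S.2 x hx _ (hφ x)) hzS h₁, ← c (φ y) z (S.2 y hy _ (hφ y)) hzS h₂,
      ← Category.assoc (f x), ← Category.assoc, e, Category.assoc]
  choose e he using fun S : ClosedSubset r =>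
    (isColimOn_colimOn D S.1).exists_desc _ (hcompat S)
  let E : colimOnClosed D r ⟶ colimOnClosed D r :=
    { app := e
      naturality := fun S T g => (isColimOn_colimOn D S.1).hom_ext fun x hx => by
        have hST : S.1 ⊆ T.1 := leOfHom g
        have : ιOn D S.1 x hx ≫ colimOnMap D hST ≫ e T =
            ιOn D S.1 x hx ≫ e S ≫ colimOnMap D hST := by
          rw [ιOn_colimOnMap_assoc, he, ← Category.assoc, he, Category.assoc, ιOn_colimOnMap]
        exact this }
  have hE : E ≫ E = E := by
    ext S
    refine (isColimOn_colimOn D S.1).hom_ext fun x hx => ?_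
    have : ιOn D S.1 x hx ≫ e S ≫ e S = ιOn D S.1 x hx ≫ e S := by
      obtain ⟨z, hz, h₁, h₂, e'⟩ := hidem x
      have hzS : z ∈ S.1 := S.2 x hx _ hz
      have hxS : φ x ∈ S.1 := S.2 x hx _ (hφ x)
      have c := (isColimOn_colimOn D S.1).compat
      rw [← Category.assoc, he, Category.assoc, he, ← c (φ x) z hxS hzS h₁,
        ← c (φ (φ x)) z (S.2 _ hxS _ (hφ _)) hzS h₂, ← Category.assoc (f x) (D.map _), e']
      simp only [Category.assoc]
    exact this
  have := isIdempotentComplete_of_hasColimitsOfSize.{w} (C := C)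
  obtain ⟨H, i, p, hip, hpi⟩ := IsIdempotentComplete.idempotents_split _ E hE
  refine ⟨r, H, hr, hr', ⟨⟨i, p, hip⟩⟩, ?_⟩
  let U : ClosedSubset r := ⟨Set.univ, fun _ _ _ _ => trivial⟩
  -- Over the whole poset the idempotent is the original `q ≫ s`, which also splits through `K`; two
  -- splittings of one idempotent are isomorphic.
  have hU : e U = q ≫ s := (isColimOn_colimOn D Set.univ).hom_ext fun x hx =>
    (he U x hx).trans (hf x)
  have h₁ : i.app U ≫ p.app U = 𝟙 _ := congrArg (fun t => t.app U) hip
  have h₂ : p.app U ≫ i.app U = q ≫ s := (congrArg (fun t => t.app U) hpi).trans hU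
  let i' : H.obj U ⟶ colimOn D Set.univ := i.app U
  let p' : colimOn D Set.univ ⟶ H.obj U := p.app U
  have h₁' : i' ≫ p' = 𝟙 _ := h₁
  have h₂' : p' ≫ i' = q ≫ s := h₂
  exact ⟨⟨i' ≫ q, s ≫ p', by
    rw [Category.assoc, ← Category.assoc q, ← h₂', Category.assoc, h₁', Category.comp_id, h₁'], by
    rw [Category.assoc, ← Category.assoc p', h₂', Category.assoc, hs, Category.comp_id, hs]⟩⟩

/-- Taking colimits over sublevel sets commutes with taking unions. -/
theorem isColimOn_colimOn_sublevel [HasColimitsOfSize.{w, w} C] (D : P ⥤ C) {Q : Type w}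
    [PartialOrder Q] {r : P → P → Prop} (hr : ∀ x y, y ≤ x → r x y) {T : Q ⥤ ClosedSubset r}
    {μ : P → Q} (hT : ∀ x q, x ∈ (T.obj q).1 ↔ μ x ≤ q) {U : Set Q}
    {S : ClosedSubset r} (hTS : ∀ q ∈ U, T.obj q ≤ S) (hSU : ∀ x ∈ S.1, μ x ∈ U) :
    IsColimOn (T ⋙ colimOnClosed D r) U
      (fun q hq => (colimOnClosed D r).map (homOfLE (hTS q hq))) where
  compat q q' hq hq' h := ((colimOnClosed D r).map_comp (T.map (homOfLE h)) _).symm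
  exists_desc {W} f hf := by
    have hμ (x : P) : x ∈ (T.obj (μ x)).1 := (hT _ _).2 le_rfl
    let F (q : Q) (hq : q ∈ U) : colimOn D (T.obj q).1 ⟶ W := f q hq
    -- The component at `x` can be read at stage `μ x`, the first containing `x`, and agrees with
    -- that at every later stage.
    have key (x : P) (q : Q) (hq : q ∈ U) (hxq : x ∈ (T.obj q).1) (hx : μ x ∈ U) :
        ιOn D (T.obj (μ x)).1 x (hμ x) ≫ F (μ x) hx = ιOn D (T.obj q).1 x hxq ≫ F q hq := by
      have h : μ x ≤ q := (hT _ _).1 hxq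
      have h' : colimOnMap D (leOfHom (T.map (homOfLE h))) ≫ F q hq = F (μ x) hx :=
        hf (μ x) q hx hq h
      rw [← h', ιOn_colimOnMap_assoc]
    obtain ⟨g, hg⟩ := (isColimOn_colimOn D S.1).exists_desc
      (fun x hx => ιOn D (T.obj (μ x)).1 x (hμ x) ≫ F (μ x) (hSU x hx)) (by
        intro x y hx hy hxy
        have hx' : x ∈ (T.obj (μ y)).1 := (T.obj (μ y)).2 y (hμ y) x (hr _ _ hxy)
        change D.map (homOfLE hxy) ≫ ιOn D (T.obj (μ y)).1 y (hμ y) ≫ F (μ y) (hSU y hy) =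
          ιOn D (T.obj (μ x)).1 x (hμ x) ≫ F (μ x) (hSU x hx)
        rw [key x (μ y) (hSU y hy) hx' (hSU x hx), ← Category.assoc,
          (isColimOn_colimOn D _).compat x y hx' (hμ y) hxy])
    refine ⟨g, fun q hq => (isColimOn_colimOn D (T.obj q).1).hom_ext fun x hx => ?_⟩
    refine Eq.trans ?_ (key x q hq hx (hSU x (hTS q hq hx)))
    refine Eq.trans ?_ (hg x (hTS q hq hx))
    exact ιOn_colimOnMap_assoc D (hTS q hq) x hx g
  hom_ext {W g g'} h := (isColimOn_colimOn D S.1).hom_ext fun x hx => by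
    have hμ : x ∈ (T.obj (μ x)).1 := (hT _ _).2 le_rfl
    let k : colimOn D S.1 ⟶ W := g
    let k' : colimOn D S.1 ⟶ W := g'
    have h' : colimOnMap D (hTS _ (hSU x hx)) ≫ k = colimOnMap D (hTS _ (hSU x hx)) ≫ k' :=
      h (μ x) (hSU x hx)
    have : ιOn D S.1 x hx ≫ k = ιOn D S.1 x hx ≫ k' := by
      rw [← ιOn_colimOnMap_assoc D (hTS _ (hSU x hx)) x hμ, h', ιOn_colimOnMap_assoc]
    exact this

/-- A retract of a colimit cocone is a colimit cocone. -/
theorem IsColimOn.of_retract {𝒮 : Type w} [Category.{w} 𝒮] {F H : 𝒮 ⥤ C} (ρ : Retract H F)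
    {Q : Type w} [PartialOrder Q] {T : Q ⥤ 𝒮} {U : Set Q} {S : 𝒮} {t : ∀ q ∈ U, T.obj q ⟶ S}
    (ht : ∀ (q q' : Q) (hq : q ∈ U) (hq' : q' ∈ U) (h : q ≤ q'),
      T.map (homOfLE h) ≫ t q' hq' = t q hq)
    (h : IsColimOn (T ⋙ F) U (fun q hq => F.map (t q hq))) :
    IsColimOn (T ⋙ H) U (fun q hq => H.map (t q hq)) where
  compat q q' hq hq' h := (H.map_comp _ _).symm.trans (congrArg H.map (ht q q' hq hq' h))
  exists_desc {W} f hf := by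
    obtain ⟨g, hg⟩ := h.exists_desc (fun q hq => ρ.r.app (T.obj q) ≫ f q hq) (by
      intro q q' hq hq' h
      have h₁ := hf q q' hq hq' h
      have h₂ := ρ.r.naturality (T.map (homOfLE h))
      refine Eq.trans ?_ (congrArg (ρ.r.app (T.obj q) ≫ ·) h₁)
      exact (Category.assoc _ _ _).symm.trans
        ((congrArg (· ≫ f q' hq') h₂).trans (Category.assoc _ _ _)))
    refine ⟨ρ.i.app S ≫ g, fun q hq => ?_⟩
    have h₁ : ρ.i.app (T.obj q) ≫ ρ.r.app (T.obj q) = 𝟙 _ :=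
      congrArg (fun t => t.app (T.obj q)) ρ.retract
    have h₂ : F.map (t q hq) ≫ g = ρ.r.app (T.obj q) ≫ f q hq := hg q hq
    let f' : H.obj (T.obj q) ⟶ W := f q hq
    have h₂' : F.map (t q hq) ≫ g = ρ.r.app (T.obj q) ≫ f' := h₂
    have h₃ : H.map (t q hq) ≫ ρ.i.app S ≫ g = f' := by
      rw [← Category.assoc, ρ.i.naturality, Category.assoc, h₂', ← Category.assoc, h₁]
      exact Category.id_comp _
    exact h₃
  hom_ext {W g g'} h' := by
    have h₁ : ρ.i.app S ≫ ρ.r.app S = 𝟙 _ := congrArg (fun t => t.app S) ρ.retract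
    have h₂ : ρ.r.app S ≫ g = ρ.r.app S ≫ g' := h.hom_ext fun q hq => by
      have h₃ : H.map (t q hq) ≫ g = H.map (t q hq) ≫ g' := h' q hq
      rw [← Category.assoc, ρ.r.naturality, Category.assoc, h₃, ← Category.assoc,
        ← ρ.r.naturality, Category.assoc]
    rw [← Category.id_comp g, ← Category.id_comp g', ← h₁, Category.assoc, h₂, Category.assoc]

end Splitting

/-! ### Assembly of the good diagram. -/

variable {C : Type u} [Category.{v} C] {P : Type w} [PartialOrder P]

theorem IsColimOn.nonempty_isColimit_univ {D : P ⥤ C} {Z : C}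
    {σ : ∀ x ∈ Set.univ, D.obj x ⟶ Z} (h : IsColimOn D Set.univ σ) (c : Cocone D) (e : Z ≅ c.pt)
    (hc : ∀ x, σ x (Set.mem_univ x) ≫ e.hom = c.ι.app x) : Nonempty (IsColimit c) := by
  choose g hg using fun s : Cocone D =>
    h.exists_desc (fun x _ => s.ι.app x) (fun x y _ _ hxy => s.w (homOfLE hxy))
  refine ⟨{ desc := fun s => e.inv ≫ g s, fac := fun s x => ?_, uniq := fun s m hm => ?_ }⟩
  · rw [← hc, Category.assoc, e.hom_inv_id_assoc, hg s x]
  · rw [Iso.eq_inv_comp]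
    refine h.hom_ext fun x hx => ?_
    rw [hg s x hx, ← hm x, ← hc, Category.assoc]

theorem retract_app {𝒮 : Type*} [Category 𝒮] {F H : 𝒮 ⥤ C} (ρ : Retract H F) (S : 𝒮) :
    ρ.i.app S ≫ ρ.r.app S = 𝟙 _ :=
  congrArg (fun t => t.app S) ρ.retract

/-- The maps of a retract of a functor are retracts of the maps of this functor. -/
def retractArrowMap {𝒮 : Type*} [Category 𝒮] {F H : 𝒮 ⥤ C} (ρ : Retract H F) {S T : 𝒮}
    (g : S ⟶ T) : RetractArrow (H.map g) (F.map g) where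
  i := Arrow.homMk (ρ.i.app S) (ρ.i.app T) (ρ.i.naturality g).symm
  r := Arrow.homMk (ρ.r.app S) (ρ.r.app T) (ρ.r.naturality g).symm
  retract := by
    ext
    · exact retract_app ρ S
    · exact retract_app ρ T

/-- The colimit over the empty set is initial and a retract of an initial object is initial. The
maps out of `H(∅)` therefore witness cofibrancy of the objects `H(S)`. -/
theorem exists_isInitial_of_retract [HasColimitsOfSize.{w, w} C] (D : P ⥤ C) {r : P → P → Prop}
    {H : ClosedSubset r ⥤ C} (ρ : Retract H (colimOnClosed D r)) :
    Nonempty (IsInitial (H.obj ⟨∅, fun _ h => h.elim⟩)) := by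
  let O : ClosedSubset r := ⟨∅, fun _ h => h.elim⟩
  have hc := isColimOn_colimOn D O.1
  choose g _ using fun Y : C => hc.exists_desc (W := Y) (fun x hx => hx.elim)
    (fun x y hx => hx.elim)
  refine ⟨IsInitial.ofUniqueHom (fun Y => ρ.i.app O ≫ g Y) fun Y m => ?_⟩
  have h : ρ.r.app O ≫ m = g Y := hc.hom_ext fun x hx => hx.elim
  rw [← h, ← Category.assoc]
  exact (Category.id_comp m).symm.trans (congrArg (· ≫ m) (retract_app ρ O)).symm

/-- Cofibrant objects are good colimits of presentable cofibrant objects. -/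
theorem exists_good_diagram {κ : Cardinal.{w}} [Fact κ.IsRegular] (hκ : ℵ₀ < κ)
    [IsCardinalLocallyPresentable C κ] {X : MorphismProperty C} (hX : X ≤ betweenPresentable C κ)
    {K : C} (hK : IsCofibrantObject.{w} X K) :
    ∃ (Q : Type w) (_ : PartialOrder Q) (D : Q ⥤ C) (ι : D ⟶ (Functor.const Q).obj K),
      IsGoodPoset κ Q ∧ IsDirectedPoset κ Q ∧ IsSmooth D ∧
      Nonempty (IsColimit (Cocone.mk K ι)) ∧
      (∀ x : Q, IsCardinalPresentable (D.obj x) κ ∧ IsCofibrantObject.{w} X (D.obj x)) ∧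
      LinksIn D (cof.{w} X) ∧ LinksIn D (po (cofPresentable X κ)) := by
  obtain ⟨P, _, D, p, _, hP', hP, hD, hp, hlatch, hlift⟩ := exists_fat_small_object hκ hX K
  obtain ⟨q, s, hs⟩ := exists_section_of_isCofibrantObject hX hK hP hp hlift
  obtain ⟨r, H, hr, hr', ⟨ρ⟩, ⟨e⟩⟩ := exists_retract_functor hκ hP hP' hD hs
  obtain ⟨Q, _, μ, hQ, hQ', hμ, hμ', hpred⟩ := exists_good_filtration Fact.out hκ hr
  let T₀ (q : Q) : ClosedSubset r := ⟨{x | μ x ≤ q}, fun x hx y h => (hμ x y h).trans hx⟩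
  have hT₀ : Monotone T₀ := fun q q' h x hx => le_trans hx h
  let T : Q ⥤ ClosedSubset r := hT₀.functor
  let U : ClosedSubset r := ⟨Set.univ, fun _ _ _ _ => trivial⟩
  have hTU (q : Q) : T.obj q ≤ U := Set.subset_univ _
  have hlower (S : ClosedSubset r) : IsLowerSet S.1 := fun x y h hx => S.2 x hx y (hr' x y h)
  have hcof {S S' : ClosedSubset r} (g : S ⟶ S') : cof.{w} X (H.map g) :=
    ⟨_, _, _, retractArrowMap ρ g, transfiniteCompositions_colimOnMap (isomorphisms_le_po X) hlatch
      (hlower S) (hlower S') (leOfHom g)⟩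
  have hpres (q : Q) : IsCardinalPresentable (H.obj (T.obj q)) κ := by
    have : IsCardinalPresentable ((colimOnClosed D r).obj (T.obj q)) κ :=
      (isColimOn_colimOn D (T.obj q).1).isCardinalPresentable (hμ' q) fun x _ => hD x
    have ρ' : Retract (H.obj (T.obj q)) ((colimOnClosed D r).obj (T.obj q)) :=
      ρ.map ((evaluation _ _).obj (T.obj q))
    exact ρ'.isCardinalPresentable κ
  have hcolim (V : Set Q) (S : ClosedSubset r) (hTS : ∀ q ∈ V, T.obj q ≤ S)
      (hSV : ∀ x ∈ S.1, μ x ∈ V) :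
      IsColimOn (T ⋙ H) V (fun q hq => H.map (homOfLE (hTS q hq))) :=
    IsColimOn.of_retract ρ (fun _ _ _ _ _ => Subsingleton.elim _ _)
      (isColimOn_colimOn_sublevel D hr' (μ := μ) (fun _ _ => Iff.rfl) hTS hSV)
  let ι : T ⋙ H ⟶ (Functor.const Q).obj K :=
    { app := fun q => H.map (homOfLE (hTU q)) ≫ e.hom
      naturality := fun q q' g => by
        have : H.map (T.map g) ≫ H.map (homOfLE (hTU q')) ≫ e.hom =
            H.map (homOfLE (hTU q)) ≫ e.hom := by
          rw [← Category.assoc, ← H.map_comp]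
          rfl
        exact this.trans (Category.comp_id _).symm }
  refine ⟨Q, inferInstance, T ⋙ H, ι, hQ, hQ', fun x hx => ?_, ?_, fun x => ⟨hpres x, ?_⟩,
    fun x y h => hcof _, fun x y h => ?_⟩
  · refine (hcolim (Set.Iio x) (T.obj x) (fun q hq => hT₀ (Set.mem_Iio.1 hq).le)
      fun z hz => Set.mem_Iio.2 (lt_of_le_of_ne hz ?_)).nonempty_isColimit
    -- A point with `μ z = x` would make `x` isolated, so at a limit `x` every point of the sublevel
    -- set already lies in an earlier one.
    rintro rfl
    exact hx.2 (hpred z)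
  · exact (hcolim Set.univ U (fun q _ => hTU q) fun _ _ => trivial).nonempty_isColimit_univ
      (Cocone.mk K ι) e fun q => rfl
  · obtain ⟨hI⟩ := exists_isInitial_of_retract D ρ
    refine ⟨_, hI, ?_⟩
    have h : H.map (homOfLE (Set.empty_subset _) : (⟨∅, fun _ h => h.elim⟩ : ClosedSubset r) ⟶
      T.obj x) = hI.to (H.obj (T.obj x)) := hI.hom_ext _ _
    have h' := hcof (homOfLE (Set.empty_subset _) : (⟨∅, fun _ h => h.elim⟩ : ClosedSubset r) ⟶
      T.obj x)
    rw [h] at h'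
    exact h'
  -- The link is a cofibration between `κ`-presentable objects, hence a trivial pushout of itself.
  · exact Or.inl (MorphismProperty.le_pushouts _ _ ⟨hcof _, hpres y, hpres x⟩)

/-! ### Projective modules. -/

section Kaplansky

variable {R : Type u} [Ring R] {M : Type v} [AddCommGroup M] [Module R M]

open Classical in
/-- The endomorphism of `M` obtained from a section `s` of `Finsupp.linearCombination R id` by
keeping only the coefficients in `A`. -/
noncomputable def truncate (s : M →ₗ[R] M →₀ R) (A : Set M) : M →ₗ[R] M :=
  Finsupp.linearCombination R id ∘ₗ Submodule.subtype _ ∘ₗ Finsupp.restrictDom R R A ∘ₗ s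

variable {s : M →ₗ[R] M →₀ R}

open Classical in
theorem truncate_mem (A : Set M) (x : M) : truncate s A x ∈ Submodule.span R A := by
  have := (Finsupp.mem_span_image_iff_linearCombination R (v := id) (s := A)
    (x := truncate s A x)).2 ⟨_, (Finsupp.restrictDom R R A (s x)).2, rfl⟩
  simpa using this

open Classical in
-- When `A` contains the supports of `s a` for `a ∈ A`, the section `s` sends `span A` to
-- combinations supported on `A`, so truncation loses nothing. Hence `truncate s A` is a projection
-- of `M` onto `span A`.
theorem truncate_apply_of_mem (hs : Function.LeftInverse (Finsupp.linearCombination R id) s)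
    {A : Set M} (hA : ∀ a ∈ A, ((s a).support : Set M) ⊆ A) {x : M}
    (hx : x ∈ Submodule.span R A) : truncate s A x = x := by
  have h : Submodule.span R A ≤ (Finsupp.supported R R A).comap s :=
    Submodule.span_le.2 fun a ha => (Finsupp.mem_supported R _).2 (hA a ha)
  have h' : (Finsupp.restrictDom R R A (s x) : M →₀ R) = s x := by
    rw [Finsupp.restrictDom_apply]
    exact Finsupp.filter_eq_self_iff _ _ |>.2 fun a ha =>
      (Finsupp.mem_supported R _).1 (h hx) (Finsupp.mem_support_iff.2 ha)
  exact (congrArg (Finsupp.linearCombination R id) h').trans (hs x)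

/-- **Kaplansky's theorem**: projective modules are direct sums of countably generated projective
modules. -/
theorem exists_isInternal_countable_of_projective [Module.Projective R M] :
    ∃ (J : Type v) (_ : DecidableEq J) (N : J → Submodule R M), DirectSum.IsInternal N ∧
      ∀ j, Module.Projective R (N j) ∧ ∃ s : Set M, s.Countable ∧ Submodule.span R s = N j := by
  classical
  obtain ⟨s, hs⟩ := Module.projective_def.1 ‹Module.Projective R M›
  obtain ⟨_, _⟩ := exists_wellFoundedLT M
  let r (x y : M) : Prop := y ∈ (s x).support
  let cl (x : M) : Set M := {y | Relation.ReflTransGen r x y}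
  have hcl (x : M) : (cl x).Countable := by
    rw [← le_aleph0_iff_set_countable, ← lt_aleph_one_iff]
    refine mk_reflTransGen_lt isRegular_aleph_one aleph0_lt_aleph_one (fun x => ?_) x
    exact ((Finset.finite_toSet _).lt_aleph0).trans aleph0_lt_aleph_one
  have hself (x : M) : x ∈ cl x := Relation.ReflTransGen.refl
  let A (m : M) : Set M := ⋃ n < m, cl n
  let B (m : M) : Set M := ⋃ n ≤ m, cl n
  have hA (m : M) : ∀ a ∈ A m, ((s a).support : Set M) ⊆ A m := by
    intro a ha y hy
    simp only [A, Set.mem_iUnion] at ha ⊢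
    obtain ⟨n, hn, ha⟩ := ha
    exact ⟨n, hn, ha.tail hy⟩
  have hB (m : M) : ∀ a ∈ B m, ((s a).support : Set M) ⊆ B m := by
    intro a ha y hy
    simp only [B, Set.mem_iUnion] at ha ⊢
    obtain ⟨n, hn, ha⟩ := ha
    exact ⟨n, hn, ha.tail hy⟩
  have hBA {n m : M} (h : n < m) : B n ⊆ A m := by
    intro x hx
    simp only [A, B, Set.mem_iUnion] at hx ⊢
    obtain ⟨k, hk, hx⟩ := hx
    exact ⟨k, hk.trans_lt h, hx⟩
  have hAB (m : M) : A m ⊆ B m := by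
    intro x hx
    simp only [A, B, Set.mem_iUnion] at hx ⊢
    obtain ⟨k, hk, hx⟩ := hx
    exact ⟨k, hk.le, hx⟩
  have hclB (m : M) : cl m ⊆ B m := fun x hx => by
    simp only [B, Set.mem_iUnion]
    exact ⟨m, le_rfl, hx⟩
  have hB' (m : M) : B m ⊆ A m ∪ cl m := by
    intro x hx
    simp only [A, B, Set.mem_iUnion, Set.mem_union] at hx ⊢
    obtain ⟨k, hk, hx⟩ := hx
    rcases hk.eq_or_lt with rfl | hk
    · exact Or.inr hx
    · exact Or.inl ⟨k, hk, hx⟩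
  let α (m : M) : M →ₗ[R] M := truncate s (A m)
  let β (m : M) : M →ₗ[R] M := truncate s (B m)
  have hα (m x : M) : α m x ∈ Submodule.span R (A m) := truncate_mem _ _
  have hβ (m x : M) : β m x ∈ Submodule.span R (B m) := truncate_mem _ _
  have hα' (m x : M) (hx : x ∈ Submodule.span R (A m)) : α m x = x :=
    truncate_apply_of_mem hs (hA m) hx
  have hβ' (m x : M) (hx : x ∈ Submodule.span R (B m)) : β m x = x :=
    truncate_apply_of_mem hs (hB m) hx
  have hspan (m : M) : Submodule.span R (A m) ≤ Submodule.span R (B m) :=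
    Submodule.span_mono (hAB m)
  -- `N m` is the complement of `span (A m)` in `span (B m)` cut out by the projection `α m`.
  let N (m : M) : Submodule R M := Submodule.span R (B m) ⊓ LinearMap.ker (α m)
  have hN (m x : M) (hx : x ∈ Submodule.span R (B m)) : x - α m x ∈ N m := by
    refine ⟨sub_mem hx (hspan m (hα m x)), ?_⟩
    change α m (x - α m x) = 0
    rw [map_sub, hα' m _ (hα m x), sub_self]
  refine ⟨M, inferInstance, N, ?_, fun m => ⟨?_, ?_⟩⟩
  · have hind : Function.Injective (DFinsupp.lsum ℕ fun m => (N m).subtype) := by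
      rw [injective_iff_map_eq_zero]
      intro f hf
      by_contra hne
      have hsupp : f.support.Nonempty := by
        rwa [Finset.nonempty_iff_ne_empty, Ne, DFinsupp.support_eq_empty]
      -- At the largest index of a vanishing sum, the component lies in `span (A m)`, where `α m` is
      -- the identity, and also in the kernel of `α m`.
      obtain ⟨m, hm, hmax⟩ := f.support.exists_max_image id hsupp
      rw [DFinsupp.lsum_apply_apply, DFinsupp.sumAddHom_apply, DFinsupp.sum,
        ← Finset.add_sum_erase _ _ hm] at hf
      have h₁ : (f m : M) ∈ Submodule.span R (A m) := by
        have h : (f m : M) = -∑ n ∈ f.support.erase m, (f n : M) := eq_neg_of_add_eq_zero_left hf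
        rw [h]
        refine neg_mem (sum_mem fun n hn => ?_)
        have hnm : n < m := lt_of_le_of_ne (hmax n (Finset.mem_of_mem_erase hn))
          (Finset.ne_of_mem_erase hn)
        exact Submodule.span_mono (hBA hnm) (f n).2.1
      have h₂ : (f m : M) = 0 := (hα' m _ h₁).symm.trans (f m).2.2
      exact (DFinsupp.mem_support_iff.1 hm) (Subtype.ext h₂)
    rw [DirectSum.isInternal_submodule_iff_iSupIndep_and_iSup_eq_top]
    refine ⟨iSupIndep_of_dfinsupp_lsum_injective N hind, ?_⟩
    have key (m : M) : Submodule.span R (B m) ≤ ⨆ n, N n := by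
      induction m using (wellFounded_lt (α := M)).induction with
      | _ m ih =>
        have h : Submodule.span R (A m) ≤ ⨆ n, N n := by
          refine Submodule.span_le.2 fun x hx => ?_
          simp only [A, Set.mem_iUnion] at hx
          obtain ⟨n, hn, hx⟩ := hx
          exact ih n hn (Submodule.subset_span (hclB n hx))
        intro x hx
        rw [← sub_add_cancel x (α m x)]
        exact add_mem (Submodule.mem_iSup_of_mem m (hN m x hx)) (h (hα m x))
    exact eq_top_iff.2 fun x _ => key x (Submodule.subset_span (hclB x (hself x)))
  · let q : M →ₗ[R] N m := LinearMap.codRestrict (N m) (β m - (α m).comp (β m))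
      fun x => hN m _ (hβ m x)
    refine Module.Projective.of_split (N m).subtype q (LinearMap.ext fun x => Subtype.ext ?_)
    change β m x - α m (β m x) = x
    rw [hβ' m x x.2.1, show α m x = 0 from x.2.2, sub_zero]
  -- Since `id - α m` kills `span (A m)` and `B m ⊆ A m ∪ cl m`, the images of the countable set `cl
  -- m` generate `N m`.
  · refine ⟨(fun x => x - α m x) '' cl m, (hcl m).image _, le_antisymm ?_ ?_⟩
    · rw [Submodule.span_le]
      rintro _ ⟨x, hx, rfl⟩
      exact hN m x (Submodule.subset_span (hclB m hx))
    · intro x hx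
      have h : Submodule.span R (B m) ≤ (Submodule.span R ((fun x => x - α m x) '' cl m)).comap
          (LinearMap.id - α m) := by
        refine Submodule.span_le.2 fun y hy => ?_
        rw [SetLike.mem_coe, Submodule.mem_comap, LinearMap.sub_apply, LinearMap.id_apply]
        rcases hB' m hy with hy | hy
        · rw [hα' m y (Submodule.subset_span hy), sub_self]
          exact zero_mem _
        · exact Submodule.subset_span ⟨y, hy, rfl⟩
      have := h hx.1
      rw [Submodule.mem_comap, LinearMap.sub_apply, LinearMap.id_apply] at this
      rwa [show α m x = 0 from hx.2, sub_zero] at this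

end Kaplansky

end GoodColimits

theorem corollary5p2 :
    (∀ (κ : Cardinal.{w}) [Fact κ.IsRegular] (_ : ℵ₀ < κ)
        (C : Type u) [Category.{v} C] [IsCardinalLocallyPresentable C κ]
        (X : MorphismProperty C) (_ : X ≤ GoodColimits.betweenPresentable C κ)
        (K : C) (_ : GoodColimits.IsCofibrantObject.{w} X K),
      ∃ (P : Type w) (_ : PartialOrder P) (D : P ⥤ C) (ι : D ⟶ (Functor.const P).obj K),
        GoodColimits.IsGoodPoset κ P ∧
        GoodColimits.IsDirectedPoset κ P ∧
        GoodColimits.IsSmooth D ∧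
        Nonempty (IsColimit (Cocone.mk K ι)) ∧
        (∀ x : P, IsCardinalPresentable (D.obj x) κ ∧
          GoodColimits.IsCofibrantObject.{w} X (D.obj x)) ∧
        GoodColimits.LinksIn D (GoodColimits.cof.{w} X) ∧
        GoodColimits.LinksIn D (GoodColimits.po (GoodColimits.cofPresentable X κ))) ∧
    (∀ (R : Type u) [Ring R] (M : Type v) [AddCommGroup M] [Module R M] [Module.Projective R M],
      ∃ (J : Type v) (_ : DecidableEq J) (N : J → Submodule R M),
        DirectSum.IsInternal N ∧
        ∀ j : J, Module.Projective R (N j) ∧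
          ∃ s : Set M, s.Countable ∧ Submodule.span R s = N j) := by
  refine ⟨fun κ _ hκ C _ _ X hX K hK => ?_, fun R _ M _ _ _ => ?_⟩
  · exact GoodColimits.exists_good_diagram hκ hX hK
  · exact GoodColimits.exists_isInternal_countable_of_projective
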